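/- Let $Y$ be a finite set. A $Y$-coloured uni-trivalent graph is a finite graph (loops and multiple edges allowed, possibly empty, possibly with vertexless circles as components, as these arise when a closed chain of struts is glued) whose vertices are trivalent, with a cyclic ordering of the three incident half-edges, or univalent, with a colour in $Y$; graphs are taken up to isomorphism preserving orderings and colours. Connected graphs are non-empty. Let $\mathcal D(Y)$ be the algebra of formal power series with coefficients in $\mathbb Q$ in these graphs, with product given by disjoint union and unit the empty graph. A series is primitive if it is a (possibly infinite) linear combination of connected graphs. A strut is a component consisting of one edge joining two univalent vertices; a series is strutless if no graph occurring in it has a strut component. Let $\mathcal D_s(Y)\subset\mathcal D(Y)$ consist of the series in which no graph has a strut component with both vertices of the same colour. For graphs $g,h$ let $\langle g,h\rangle\in\mathcal D(\emptyset)$ be the sum, over all colour-preserving bijections from the univalent vertices of $g$ to those of $h$, of the trivalent graph obtained by identifying matched vertices and erasing the resulting bivalent vertices (so $\langle g,h\rangle=0$ if for some colour the numbers of vertices differ). The pairing $\langle F,G\rangle$ of two series $F=\sum_g F_g\,g$ and $G=\sum_h G_h\,h$ is said to be defined if for every trivalent graph $\Gamma$ there are only finitely many pairs $(g,h)$ with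 $F_g\neq0$, $G_h\ne 0$ such that $\Gamma$ occurs in $\langle g,h\rangle$, and then $\langle F,G\rangle=\sum_{g,h}F_gG_h\langle g,h\rangle$. Its part supported on connected graphs is denoted $\langle F,G\rangle_c$. **Theorem 2.1.** Let $B\in\mathcal D(Y)$ and $C\in\mathcal D_s(Y)$ be primitive. If the pairing $\langle\exp B,\exp C\rangle$ is defined, then $$\langle \exp B,\exp C\rangle=\exp\,\langle\exp B,\exp C\rangle_c .$$ Moreover, the pairing $\langle\exp B,\exp C\rangle$ is always defined if $B$ or $C$ is strutless. -/

import Mathlib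

universe u

namespace UniTri

/-- `TwoEnded f`: the map `f`, sending an end to the edge it belongs to, has only fibres with
exactly two elements (ordinary edges) or no element (circles without vertices). -/
def TwoEnded {X E : Type} (f : X → E) : Prop :=
  ∀ e : E, (f ⁻¹' {e}).ncard = 0 ∨ (f ⁻¹' {e}).ncard = 2

/-- A (finite) `Y`-coloured uni-trivalent diagram.  The trivalent vertices, with the cyclic
ordering of their incident half-edges, are the orbits of `rot` on the set `T` of half-edges at
trivalent vertices (all orbits have exactly three elements).  `L` is the set of univalent
vertices, `col` their colours, `E` the set of edges.  `inc` sends each half-edge (one for each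
element of `T`, one for each univalent vertex) to its edge.  Loops and multiple edges are
allowed.  An edge without ends is a circle without vertices: this is what a closed chain of
struts becomes when its univalent vertices are glued. -/
structure Diagram (Y : Type u) : Type (max 1 u) where
  T : Type
  L : Type
  E : Type
  finT : Finite T
  finL : Finite L
  finE : Finite E
  rot : Equiv.Perm T
  rot_ne : ∀ t, rot t ≠ t
  rot_rot_rot : ∀ t, rot (rot (rot t)) = t
  col : L → Y
  inc : T ⊕ L → E
  twoEnded : TwoEnded inc

attribute [instance] Diagram.finT Diagram.finL Diagram.finE

variable {Y : Type u}

namespace Diagram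

/-- Isomorphisms of diagrams preserve cyclic orderings, colours and incidence. -/
structure Iso (g h : Diagram Y) where
  eT : g.T ≃ h.T
  eL : g.L ≃ h.L
  eE : g.E ≃ h.E
  rot_comm : ∀ t, h.rot (eT t) = eT (g.rot t)
  col_comm : ∀ l, h.col (eL l) = g.col l
  inc_comm : ∀ x, h.inc (Sum.map eT eL x) = eE (g.inc x)

def Iso.refl (g : Diagram Y) : Iso g g where
  eT := Equiv.refl _
  eL := Equiv.refl _
  eE := Equiv.refl _
  rot_comm _ := rfl
  col_comm _ := rfl
  inc_comm x := by cases x <;> rfl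

def Iso.symm {g h : Diagram Y} (f : Iso g h) : Iso h g where
  eT := f.eT.symm
  eL := f.eL.symm
  eE := f.eE.symm
  rot_comm t := by
    apply f.eT.injective
    rw [← f.rot_comm]
    simp
  col_comm l := by
    rw [← f.col_comm]
    simp
  inc_comm x := by
    apply f.eE.injective
    rw [← f.inc_comm]
    cases x <;> simp

def Iso.trans {g h k : Diagram Y} (f : Iso g h) (f' : Iso h k) : Iso g k where
  eT := f.eT.trans f'.eT
  eL := f.eL.trans f'.eL
  eE := f.eE.trans f'.eE
  rot_comm t := by simp [f.rot_comm, f'.rot_comm]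
  col_comm l := by simp [f.col_comm, f'.col_comm]
  inc_comm x := by
    have h1 := f.inc_comm x
    have h2 := f'.inc_comm (Sum.map f.eT f.eL x)
    rw [h1] at h2
    rw [Equiv.trans_apply, ← h2]
    cases x <;> rfl

instance setoid (Y : Type u) : Setoid (Diagram Y) where
  r g h := Nonempty (Iso g h)
  iseqv :=
    { refl := fun g => ⟨Iso.refl g⟩
      symm := fun ⟨f⟩ => ⟨f.symm⟩
      trans := fun ⟨f⟩ ⟨f'⟩ => ⟨f.trans f'⟩ }

/-- The empty diagram. -/
def empty (Y : Type u) : Diagram Y where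
  T := Empty
  L := Empty
  E := Empty
  finT := inferInstance
  finL := inferInstance
  finE := inferInstance
  rot := Equiv.refl _
  rot_ne t := t.elim
  rot_rot_rot t := t.elim
  col l := l.elim
  inc x := x.elim Empty.elim Empty.elim
  twoEnded e := e.elim

/-- The incidence map of a disjoint union. -/
def unionInc (g h : Diagram Y) : (g.T ⊕ h.T) ⊕ (g.L ⊕ h.L) → g.E ⊕ h.E :=
  Sum.elim (Sum.map (fun t => g.inc (Sum.inl t)) (fun t => h.inc (Sum.inl t)))
    (Sum.map (fun l => g.inc (Sum.inr l)) (fun l => h.inc (Sum.inr l)))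

theorem unionInc_twoEnded (g h : Diagram Y) : TwoEnded (unionInc g h) := by
  rintro (e | e)
  · have : unionInc g h ⁻¹' {Sum.inl e}
        = Sum.map Sum.inl Sum.inl '' (g.inc ⁻¹' {e}) := by
      ext ((x | x) | (x | x)) <;> simp [unionInc]
    rw [this, Set.ncard_image_of_injective _
      (Sum.map_injective.2 ⟨Sum.inl_injective, Sum.inl_injective⟩)]
    exact g.twoEnded e
  · have : unionInc g h ⁻¹' {Sum.inr e}
        = Sum.map Sum.inr Sum.inr '' (h.inc ⁻¹' {e}) := by
      ext ((x | x) | (x | x)) <;> simp [unionInc]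
    rw [this, Set.ncard_image_of_injective _
      (Sum.map_injective.2 ⟨Sum.inr_injective, Sum.inr_injective⟩)]
    exact h.twoEnded e

/-- The disjoint union of two diagrams. -/
def union (g h : Diagram Y) : Diagram Y where
  T := g.T ⊕ h.T
  L := g.L ⊕ h.L
  E := g.E ⊕ h.E
  finT := inferInstance
  finL := inferInstance
  finE := inferInstance
  rot := Equiv.sumCongr g.rot h.rot
  rot_ne := by rintro (t | t) <;> simp [g.rot_ne, h.rot_ne]
  rot_rot_rot := by rintro (t | t) <;> simp [g.rot_rot_rot, h.rot_rot_rot]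
  col := Sum.elim g.col h.col
  inc := unionInc g h
  twoEnded := unionInc_twoEnded g h

def Iso.union {g g' h h' : Diagram Y} (f : Iso g g') (k : Iso h h') :
    Iso (g.union h) (g'.union h') where
  eT := Equiv.sumCongr f.eT k.eT
  eL := Equiv.sumCongr f.eL k.eL
  eE := Equiv.sumCongr f.eE k.eE
  rot_comm := by
    rintro (t | t)
    · exact congrArg Sum.inl (f.rot_comm t)
    · exact congrArg Sum.inr (k.rot_comm t)
  col_comm := by
    rintro (t | t)
    · exact f.col_comm t
    · exact k.col_comm t
  inc_comm := by
    rintro ((t | t) | (t | t))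
    · exact congrArg Sum.inl (f.inc_comm (Sum.inl t))
    · exact congrArg Sum.inr (k.inc_comm (Sum.inl t))
    · exact congrArg Sum.inl (f.inc_comm (Sum.inr t))
    · exact congrArg Sum.inr (k.inc_comm (Sum.inr t))

/-- Two edges are adjacent if they have ends at a common trivalent vertex.  (Two different edges
never share a univalent vertex.) -/
def EdgeAdj (g : Diagram Y) (e e' : g.E) : Prop :=
  ∃ t : g.T, g.inc (Sum.inl t) = e ∧ g.inc (Sum.inl (g.rot t)) = e'

/-- A diagram is connected if it is nonempty and any two of its edges are joined by a chain of
adjacent edges.  (Every vertex lies on an edge.) -/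
def Connected (g : Diagram Y) : Prop :=
  Nonempty g.E ∧ ∀ e e' : g.E, Relation.EqvGen g.EdgeAdj e e'

/-- Some component is a strut, that is, a single edge joining two univalent vertices. -/
def HasStrut (g : Diagram Y) : Prop :=
  ∃ l l' : g.L, l ≠ l' ∧ g.inc (Sum.inr l) = g.inc (Sum.inr l')

/-- Some component is a strut whose two univalent vertices have the same colour. -/
def HasSameColourStrut (g : Diagram Y) : Prop :=
  ∃ l l' : g.L, l ≠ l' ∧ g.inc (Sum.inr l) = g.inc (Sum.inr l') ∧ g.col l = g.col l'

theorem Iso.connected {g h : Diagram Y} (f : Iso g h) (hg : g.Connected) : h.Connected := by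
  obtain ⟨⟨e⟩, hg⟩ := hg
  refine ⟨⟨f.eE e⟩, fun a b => ?_⟩
  have key : ∀ x y, Relation.EqvGen g.EdgeAdj x y →
      Relation.EqvGen h.EdgeAdj (f.eE x) (f.eE y) := by
    intro x y hxy
    induction hxy with
    | rel x y hxy =>
      obtain ⟨t, rfl, rfl⟩ := hxy
      refine Relation.EqvGen.rel _ _ ⟨f.eT t, f.inc_comm (Sum.inl t), ?_⟩
      rw [f.rot_comm]
      exact f.inc_comm (Sum.inl (g.rot t))
    | refl x => exact Relation.EqvGen.refl _
    | symm x y _ ih => exact Relation.EqvGen.symm _ _ ih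
    | trans x y z _ _ ih1 ih2 => exact Relation.EqvGen.trans _ _ _ ih1 ih2
  simpa using key _ _ (hg (f.eE.symm a) (f.eE.symm b))

theorem Iso.hasStrut {g h : Diagram Y} (f : Iso g h) (hg : g.HasStrut) : h.HasStrut := by
  obtain ⟨l, l', hne, he⟩ := hg
  refine ⟨f.eL l, f.eL l', fun hh => hne (f.eL.injective hh), ?_⟩
  have h1 := f.inc_comm (Sum.inr l)
  have h2 := f.inc_comm (Sum.inr l')
  simp only [Sum.map_inr] at h1 h2
  rw [h1, h2, he]

theorem Iso.hasSameColourStrut {g h : Diagram Y} (f : Iso g h) (hg : g.HasSameColourStrut) :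
    h.HasSameColourStrut := by
  obtain ⟨l, l', hne, he, hc⟩ := hg
  refine ⟨f.eL l, f.eL l', fun hh => hne (f.eL.injective hh), ?_, ?_⟩
  · have h1 := f.inc_comm (Sum.inr l)
    have h2 := f.inc_comm (Sum.inr l')
    simp only [Sum.map_inr] at h1 h2
    rw [h1, h2, he]
  · rw [f.col_comm, f.col_comm, hc]

/-! ### Gluing -/

/-- The ways of identifying the univalent vertices of `g` with those of `h`, colour by colour. -/
def Matching (g h : Diagram Y) : Type :=
  {φ : g.L ≃ h.L // ∀ l, h.col (φ l) = g.col l}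

/-- The edges which are joined when the univalent vertices are identified along `φ`. -/
inductive GlueRel (g h : Diagram Y) (φ : Matching g h) : g.E ⊕ h.E → g.E ⊕ h.E → Prop
  | glue (l : g.L) :
      GlueRel g h φ (Sum.inl (g.inc (Sum.inr l))) (Sum.inr (h.inc (Sum.inr (φ.1 l))))

/-- The half-edges at trivalent vertices, sent to the edges of the glued diagram.  Joined edges
become one edge (the identified vertices are erased from it). -/
def glueInc (g h : Diagram Y) (φ : Matching g h) :
    (g.T ⊕ h.T) ⊕ Empty → Quot (GlueRel g h φ) :=
  Sum.elim
    (fun t => Quot.mk _ (Sum.map (fun t => g.inc (Sum.inl t)) (fun t => h.inc (Sum.inl t)) t))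
    Empty.elim

end Diagram

/-- Joining two ends `a ≠ b` keeps the property that edges have two ends or none. -/
theorem TwoEnded.join {X X' E E' : Type} [Finite X] {F : X → E} (hF : TwoEnded F) (a b : X)
    (hab : a ≠ b) (i : X' → X) (hi : Function.Injective i)
    (hr : ∀ x, x ∈ Set.range i ↔ x ≠ a ∧ x ≠ b) (p : E → E') (hp : Function.Surjective p)
    (hk : ∀ u w, p u = p w ↔ u = w ∨ (u = F a ∧ w = F b) ∨ (u = F b ∧ w = F a)) :
    TwoEnded (fun x => p (F (i x))) := by
  intro e'
  obtain ⟨e, rfl⟩ := hp e'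
  have hcard : ((fun x => p (F (i x))) ⁻¹' {p e}).ncard
      = {x | x ≠ a ∧ x ≠ b ∧ p (F x) = p e}.ncard := by
    rw [← Set.ncard_image_of_injective _ hi]
    congr 1
    ext x
    constructor
    · rintro ⟨y, hy, rfl⟩
      exact ⟨((hr _).1 ⟨y, rfl⟩).1, ((hr _).1 ⟨y, rfl⟩).2, hy⟩
    · rintro ⟨h1, h2, h3⟩
      obtain ⟨y, rfl⟩ := (hr x).2 ⟨h1, h2⟩
      exact ⟨y, h3, rfl⟩
  rw [hcard]
  have two : ∀ c : X, ∃ c', c' ≠ c ∧ F ⁻¹' {F c} = {c, c'} := by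
    intro c
    have hc : c ∈ F ⁻¹' {F c} := rfl
    rcases hF (F c) with h | h
    · rw [Set.ncard_eq_zero] at h
      rw [h] at hc
      exact hc.elim
    · obtain ⟨x, y, hxy, hs⟩ := Set.ncard_eq_two.1 h
      rw [hs] at hc ⊢
      rcases hc with rfl | hc
      · exact ⟨y, hxy.symm, rfl⟩
      · rw [Set.mem_singleton_iff] at hc
        subst hc
        exact ⟨x, hxy, Set.pair_comm _ _⟩
  by_cases he : e = F a ∨ e = F b
  · obtain ⟨a', ha', hfa⟩ := two a
    obtain ⟨b', hb', hfb⟩ := two b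
    have ma : ∀ x, F x = F a ↔ x = a ∨ x = a' := fun x => by
      have := congrArg (x ∈ ·) hfa
      simpa using this
    have mb : ∀ x, F x = F b ↔ x = b ∨ x = b' := fun x => by
      have := congrArg (x ∈ ·) hfb
      simpa using this
    have hset : {x | x ≠ a ∧ x ≠ b ∧ p (F x) = p e}
        = {x | x ≠ a ∧ x ≠ b ∧ (F x = F a ∨ F x = F b)} := by
      ext x
      simp only [Set.mem_ofPred_eq, hk]
      rcases he with rfl | rfl <;> tauto
    rw [hset]
    by_cases hE : F a = F b
    · left
      rw [Set.ncard_eq_zero]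
      ext x
      have hb := (ma b).1 hE.symm
      simp only [Set.mem_ofPred_eq, Set.mem_empty_iff_false, iff_false, ← hE, or_self, ma]
      rcases hb with hb | hb
      · exact absurd hb.symm hab
      · subst hb
        tauto
    · right
      rw [Set.ncard_eq_two]
      have haa := (ma a').2 (Or.inr rfl)
      have hbb := (mb b').2 (Or.inr rfl)
      refine ⟨a', b', fun h => hE (by rw [← haa, h, hbb]), ?_⟩
      ext x
      simp only [Set.mem_ofPred_eq, ma, mb, Set.mem_insert_iff, Set.mem_singleton_iff]
      have n1 : a' ≠ b := fun h => hE (by rw [← haa, h])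
      have n2 : b' ≠ a := fun h => hE (by rw [← hbb, h])
      constructor
      · rintro ⟨h1, h2, h3⟩
        tauto
      · rintro (rfl | rfl) <;> tauto
  · have hset : {x | x ≠ a ∧ x ≠ b ∧ p (F x) = p e} = F ⁻¹' {e} := by
      ext x
      simp only [Set.mem_ofPred_eq, hk, Set.mem_preimage, Set.mem_singleton_iff]
      push Not at he
      constructor
      · rintro ⟨h1, h2, h3 | h3 | h3⟩
        · exact h3
        · exact absurd h3.2 he.2
        · exact absurd h3.2 he.1
      · rintro rfl
        exact ⟨fun h => he.1 (by rw [h]), fun h => he.2 (by rw [h]), Or.inl rfl⟩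
    rw [hset]
    exact hF e

/-- Joining pairs of ends indexed by `M` keeps the property that edges have two ends or none. -/
theorem TwoEnded.glue (M : Type) [Finite M] : ∀ (A E : Type) (_ : Finite A)
    (f : A → E) (p q : M → E), TwoEnded (Sum.elim f (Sum.elim p q)) →
    TwoEnded (fun a => Quot.mk (fun u w => ∃ m, u = p m ∧ w = q m) (f a)) := by
  refine Finite.induction_empty_option (P := fun M => ∀ (A E : Type) (_ : Finite A)
    (f : A → E) (p q : M → E), TwoEnded (Sum.elim f (Sum.elim p q)) →
    TwoEnded (fun a => Quot.mk (fun u w => ∃ m, u = p m ∧ w = q m) (f a))) ?_ ?_ ?_ M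
  · intro M N e ih A E _ f p q h
    have h' : TwoEnded (Sum.elim f (Sum.elim (p ∘ e) (q ∘ e))) := by
      intro x
      have := h x
      have hs : Sum.elim f (Sum.elim p q) ⁻¹' {x} = Sum.map id (Sum.map e e) ''
          (Sum.elim f (Sum.elim (p ∘ e) (q ∘ e)) ⁻¹' {x}) := by
        ext (y | y | y)
        · simp
        · constructor
          · intro hy
            exact ⟨Sum.inr (Sum.inl (e.symm y)), by simpa using hy, by simp⟩
          · rintro ⟨z | z | z, hz, hzy⟩ <;> simp_all
        · constructor
          · intro hy
            exact ⟨Sum.inr (Sum.inr (e.symm y)), by simpa using hy, by simp⟩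
          · rintro ⟨z | z | z, hz, hzy⟩ <;> simp_all
      rw [hs, Set.ncard_image_of_injective _ (Sum.map_injective.2 ⟨Function.injective_id,
        Sum.map_injective.2 ⟨e.injective, e.injective⟩⟩)] at this
      exact this
    have := ih A E ‹_› f (p ∘ e) (q ∘ e) h'
    have hrel : (fun u w => ∃ m, u = (p ∘ e) m ∧ w = (q ∘ e) m)
        = (fun u w => ∃ m, u = p m ∧ w = q m) := by
      funext u w
      exact propext ⟨fun ⟨m, hm⟩ => ⟨e m, hm⟩,
        fun ⟨m, h1, h2⟩ => ⟨e.symm m, by simpa using h1, by simpa using h2⟩⟩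
    rw [hrel] at this
    exact this
  · intro A E _ f p q h e'
    obtain ⟨e, rfl⟩ := Quot.exists_rep e'
    have := h e
    have hs : Sum.elim f (Sum.elim p q) ⁻¹' {e} = Sum.inl '' ((fun a =>
        Quot.mk (fun u w => ∃ m : PEmpty, u = p m ∧ w = q m) (f a)) ⁻¹' {Quot.mk _ e}) := by
      have inj : ∀ u w, Quot.mk (fun u w => ∃ m : PEmpty, u = p m ∧ w = q m) u = Quot.mk _ w →
          u = w := fun u w huw =>
        congrArg (Quot.lift (fun z : E => z) (fun _ _ ⟨m, _⟩ => m.elim)) huw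
      ext (y | y | y)
      · simp only [Set.mem_preimage, Sum.elim_inl, Set.mem_singleton_iff, Set.mem_image,
          Sum.inl.injEq, exists_eq_right]
        exact ⟨fun hh => by rw [hh], inj _ _⟩
      · exact y.elim
      · exact y.elim
    rw [hs, Set.ncard_image_of_injective _ Sum.inl_injective] at this
    exact this
  · intro M _ ih A E _ f p q h
    have hM : Finite M := inferInstance
    let r0 : E → E → Prop := fun u w => u = p none ∧ w = q none
    have hk : ∀ u w, Quot.mk r0 u = Quot.mk r0 w ↔
        u = w ∨ (u = p none ∧ w = q none) ∨ (u = q none ∧ w = p none) := by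
      intro u w
      constructor
      · intro huw
        have := Quot.eqvGen_exact huw
        induction this with
        | rel x y hxy => exact Or.inr (Or.inl hxy)
        | refl x => exact Or.inl rfl
        | symm x y _ ih1 =>
          rcases ih1 (Quot.eqvGen_sound ‹_›) with rfl | h1 | h1
          · exact Or.inl rfl
          · exact Or.inr (Or.inr ⟨h1.2, h1.1⟩)
          · exact Or.inr (Or.inl ⟨h1.2, h1.1⟩)
        | trans x y z _ _ ih1 ih2 =>
          have h1 := ih1 (Quot.eqvGen_sound ‹_›)
          have h2 := ih2 (Quot.eqvGen_sound ‹_›)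
          grind
      · rintro (rfl | h1 | h1)
        · rfl
        · exact Quot.sound h1
        · exact (Quot.sound (r := r0) ⟨h1.2, h1.1⟩).symm
    have step := h.join (Sum.inr (Sum.inl none)) (Sum.inr (Sum.inr none)) (by simp)
      (Sum.map id (Sum.map some some) : A ⊕ (M ⊕ M) → A ⊕ (Option M ⊕ Option M))
      (Sum.map_injective.2 ⟨Function.injective_id, Sum.map_injective.2
        ⟨Option.some_injective _, Option.some_injective _⟩⟩)
      (by rintro (x | x | x)
          · simp
          · cases x <;> simp
          · cases x <;> simp) (Quot.mk r0) Quot.mk_surjective hk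
    have step' := ih A (Quot r0) ‹_› (fun a => Quot.mk r0 (f a))
      (fun m => Quot.mk r0 (p (some m))) (fun m => Quot.mk r0 (q (some m))) (by
        convert step using 1
        funext x
        rcases x with x | x | x <;> rfl)
    intro e'
    obtain ⟨e, rfl⟩ := Quot.exists_rep e'
    have := step' (Quot.mk _ (Quot.mk r0 e))
    have hs : (fun a => Quot.mk (fun u w => ∃ m, u = p m ∧ w = q m) (f a)) ⁻¹' {Quot.mk _ e}
        = (fun a => Quot.mk (fun u w => ∃ m, u = Quot.mk r0 (p (some m)) ∧
          w = Quot.mk r0 (q (some m))) (Quot.mk r0 (f a))) ⁻¹' {Quot.mk _ (Quot.mk r0 e)} := by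
      ext a
      simp only [Set.mem_preimage, Set.mem_singleton_iff]
      constructor
      · intro hh
        refine congrArg (Quot.lift (fun z => Quot.mk (fun u w => ∃ m, u = Quot.mk r0 (p (some m))
          ∧ w = Quot.mk r0 (q (some m))) (Quot.mk r0 z)) ?_) hh
        rintro x y ⟨m, rfl, rfl⟩
        cases m with
        | none => exact congrArg _ (Quot.sound ⟨rfl, rfl⟩)
        | some m => exact Quot.sound ⟨m, rfl, rfl⟩
      · intro hh
        refine congrArg (Quot.lift (Quot.lift (fun z => Quot.mk (fun u w => ∃ m, u = p m ∧
          w = q m) z) ?_) ?_) hh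
        · rintro x y ⟨rfl, rfl⟩
          exact Quot.sound ⟨none, rfl, rfl⟩
        · rintro x y ⟨m, rfl, rfl⟩
          exact Quot.sound ⟨some m, rfl, rfl⟩
    rw [hs]
    exact this

namespace Diagram

theorem glueInc_twoEnded (g h : Diagram Y) (φ : Matching g h) : TwoEnded (glueInc g h φ) := by
  have h1 := unionInc_twoEnded g h
  let f : g.T ⊕ h.T → g.E ⊕ h.E :=
    Sum.map (fun t => g.inc (Sum.inl t)) (fun t => h.inc (Sum.inl t))
  let p : g.L → g.E ⊕ h.E := fun l => Sum.inl (g.inc (Sum.inr l))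
  let q : g.L → g.E ⊕ h.E := fun l => Sum.inr (h.inc (Sum.inr (φ.1 l)))
  have h2 : TwoEnded (Sum.elim f (Sum.elim p q)) := by
    intro e
    have := h1 e
    have hs : unionInc g h ⁻¹' {e} = Equiv.sumCongr (Equiv.refl (g.T ⊕ h.T))
        (Equiv.sumCongr (Equiv.refl g.L) φ.1) '' (Sum.elim f (Sum.elim p q) ⁻¹' {e}) := by
      ext x
      rw [Equiv.image_eq_preimage_symm]
      rcases x with (x | x) | (x | x) <;> simp [unionInc, f, p, q]
    rw [hs, Set.ncard_image_of_injective _ (Equiv.injective _)] at this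
    exact this
  have h3 := TwoEnded.glue g.L (g.T ⊕ h.T) (g.E ⊕ h.E) inferInstance f p q h2
  have hrel : (fun u w => ∃ m, u = p m ∧ w = q m) = GlueRel g h φ := by
    funext u w
    refine propext ⟨?_, ?_⟩
    · rintro ⟨m, rfl, rfl⟩
      exact GlueRel.glue m
    · rintro ⟨m⟩
      exact ⟨m, rfl, rfl⟩
  rw [hrel] at h3
  intro e
  have hs : glueInc g h φ ⁻¹' {e}
      = Sum.inl '' ((fun a => Quot.mk (GlueRel g h φ) (f a)) ⁻¹' {e}) := by
    ext (x | x)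
    · simp [glueInc, f]
    · exact x.elim
  rw [hs, Set.ncard_image_of_injective _ Sum.inl_injective]
  exact h3 e

/-- The trivalent diagram obtained from `g` and `h` by identifying their univalent vertices
along `φ`. -/
def glue (g h : Diagram Y) (φ : Matching g h) : Diagram Empty where
  T := g.T ⊕ h.T
  L := Empty
  E := Quot (GlueRel g h φ)
  finT := inferInstance
  finL := inferInstance
  finE := inferInstance
  rot := Equiv.sumCongr g.rot h.rot
  rot_ne := by rintro (t | t) <;> simp [g.rot_ne, h.rot_ne]
  rot_rot_rot := by rintro (t | t) <;> simp [g.rot_rot_rot, h.rot_rot_rot]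
  col l := l
  inc := glueInc g h φ
  twoEnded := glueInc_twoEnded g h φ

/-- Matchings are carried along by isomorphisms. -/
def Matching.congr {g g' h h' : Diagram Y} (f : Iso g g') (k : Iso h h') :
    Matching g h ≃ Matching g' h' where
  toFun φ := ⟨(f.eL.symm.trans φ.1).trans k.eL, fun l => by
    rw [Equiv.trans_apply, k.col_comm, Equiv.trans_apply, φ.2]
    exact f.symm.col_comm l⟩
  invFun φ := ⟨(f.eL.trans φ.1).trans k.eL.symm, fun l => by
    have := k.symm.col_comm (φ.1 (f.eL l))
    rw [φ.2, f.col_comm] at this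
    exact this⟩
  left_inv φ := by
    apply Subtype.ext
    ext l
    simp
  right_inv φ := by
    apply Subtype.ext
    ext l
    simp

theorem Matching.congr_apply {g g' h h' : Diagram Y} (f : Iso g g') (k : Iso h h')
    (φ : Matching g h) (l : g.L) : (Matching.congr f k φ).1 (f.eL l) = k.eL (φ.1 l) := by
  change k.eL (φ.1 (f.eL.symm (f.eL l))) = _
  rw [Equiv.symm_apply_apply]

/-- Gluing isomorphic diagrams along corresponding matchings gives isomorphic diagrams. -/
def Iso.glue {g g' h h' : Diagram Y} (f : Iso g g') (k : Iso h h') (φ : Matching g h) :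
    Iso (g.glue h φ) (g'.glue h' (Matching.congr f k φ)) where
  eT := Equiv.sumCongr f.eT k.eT
  eL := Equiv.refl _
  eE := Quot.congr (Equiv.sumCongr f.eE k.eE) (by
    have key : ∀ l, g'.inc (Sum.inr (f.eL l)) = f.eE (g.inc (Sum.inr l)) :=
      fun l => f.inc_comm (Sum.inr l)
    have key' : ∀ l, h'.inc (Sum.inr (k.eL l)) = k.eE (h.inc (Sum.inr l)) :=
      fun l => k.inc_comm (Sum.inr l)
    intro a b
    constructor
    · rintro ⟨l⟩
      have := GlueRel.glue (φ := Matching.congr f k φ) (f.eL l)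
      rw [Matching.congr_apply, key, key'] at this
      exact this
    · intro hab
      generalize ha : Equiv.sumCongr f.eE k.eE a = a' at hab
      generalize hb : Equiv.sumCongr f.eE k.eE b = b' at hab
      obtain ⟨l'⟩ := hab
      obtain ⟨l, rfl⟩ := f.eL.surjective l'
      have e1 : a = Sum.inl (g.inc (Sum.inr l)) := by
        apply (Equiv.sumCongr f.eE k.eE).injective
        rw [ha, key]
        rfl
      have e2 : b = Sum.inr (h.inc (Sum.inr (φ.1 l))) := by
        apply (Equiv.sumCongr f.eE k.eE).injective
        rw [hb]
        rw [Matching.congr_apply, key']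
        rfl
      rw [e1, e2]
      exact GlueRel.glue l)
  rot_comm := by
    rintro (t | t)
    · exact congrArg Sum.inl (f.rot_comm t)
    · exact congrArg Sum.inr (k.rot_comm t)
  col_comm l := l.elim
  inc_comm := by
    rintro ((t | t) | t)
    · exact congrArg (fun z => Quot.mk _ (Sum.inl z)) (f.inc_comm (Sum.inl t))
    · exact congrArg (fun z => Quot.mk _ (Sum.inr z)) (k.inc_comm (Sum.inl t))
    · exact t.elim

end Diagram

/-! ### Isomorphism classes and formal power series -/

/-- `Y`-coloured uni-trivalent graphs, up to isomorphism. -/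
def UTGraph (Y : Type u) : Type (max 1 u) := Quotient (Diagram.setoid Y)

namespace UTGraph

/-- The isomorphism class of a diagram. -/
def mk (g : Diagram Y) : UTGraph Y := Quotient.mk (Diagram.setoid Y) g

/-- The empty graph. -/
def empty (Y : Type u) : UTGraph Y := mk (Diagram.empty Y)

/-- Disjoint union of graphs. -/
def union : UTGraph Y → UTGraph Y → UTGraph Y :=
  Quotient.map₂ Diagram.union fun _ _ ⟨f⟩ _ _ ⟨k⟩ => ⟨f.union k⟩

def Connected : UTGraph Y → Prop :=
  Quotient.lift Diagram.Connected fun _ _ ⟨f⟩ => propext ⟨f.connected, f.symm.connected⟩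

def HasStrut : UTGraph Y → Prop :=
  Quotient.lift Diagram.HasStrut fun _ _ ⟨f⟩ => propext ⟨f.hasStrut, f.symm.hasStrut⟩

def HasSameColourStrut : UTGraph Y → Prop :=
  Quotient.lift Diagram.HasSameColourStrut fun _ _ ⟨f⟩ =>
    propext ⟨f.hasSameColourStrut, f.symm.hasSameColourStrut⟩

/-- The number of ways of identifying the univalent vertices of `g` with those of `h`, colour by
colour, that result in the trivalent graph `Γ`. -/
noncomputable def glueCount (Γ : UTGraph Empty) : UTGraph Y → UTGraph Y → ℕ :=
  Quotient.lift₂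
    (fun g h : Diagram Y => Nat.card {φ : Diagram.Matching g h // mk (g.glue h φ) = Γ})
    (fun _ _ _ _ ⟨f⟩ ⟨k⟩ => Nat.card_congr
      ((Diagram.Matching.congr f k).subtypeEquiv fun φ => by
        have h : mk (Diagram.glue _ _ φ) = mk (Diagram.glue _ _ (Diagram.Matching.congr f k φ)) :=
          Quotient.sound ⟨f.glue k φ⟩
        rw [h]))

end UTGraph

/-- The space `𝒟(Y)` of formal power series in `Y`-coloured uni-trivalent graphs with rational
coefficients: `F g` is the coefficient of `g`.  Its product is `Series.mul` (not the pointwise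
product of functions). -/
abbrev Series (Y : Type u) : Type (max 1 u) := UTGraph Y → ℚ

namespace Series

open Classical in
/-- The unit: the empty graph. -/
noncomputable def one (Y : Type u) : Series Y := fun g => if g = UTGraph.empty Y then 1 else 0

/-- The product extending disjoint union: the coefficient of `g` is the (finite) sum over all
`g₁`, `g₂` with `g = g₁ ⊔ g₂`. -/
noncomputable def mul (F G : Series Y) : Series Y := fun g =>
  ∑ᶠ p : {p : UTGraph Y × UTGraph Y // p.1.union p.2 = g}, F p.1.1 * G p.1.2

/-- Powers for the product `Series.mul`. -/
noncomputable def pow (F : Series Y) : ℕ → Series Y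
  | 0 => one Y
  | n + 1 => mul F (pow F n)

/-- `exp F = ∑ₙ Fⁿ / n!`, coefficient by coefficient.  It is used for series without constant term
only; then only finitely many `n` contribute to each coefficient. -/
noncomputable def exp (F : Series Y) : Series Y := fun g =>
  ∑ᶠ n : ℕ, ((n.factorial : ℚ))⁻¹ * pow F n g

/-- A series is primitive if it is a sum of connected graphs. -/
def IsPrimitive (F : Series Y) : Prop := ∀ g, F g ≠ 0 → g.Connected

/-- `𝒟ₛ(Y)`: the series of graphs without a strut component whose two vertices have the same
colour. -/
def Ds (Y : Type u) : Set (Series Y) := {F | ∀ g, F g ≠ 0 → ¬ g.HasSameColourStrut}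

/-- Series of graphs without strut components. -/
def IsStrutless (F : Series Y) : Prop := ∀ g, F g ≠ 0 → ¬ g.HasStrut

open Classical in
/-- The primitive (connected) part of a series. -/
noncomputable def primitivePart (F : Series Y) : Series Y := fun g =>
  if g.Connected then F g else 0

/-- The pairing `⟨F, G⟩` is defined if only finitely many pairs of terms of `F` and `G`
contribute to each trivalent graph. -/
def PairingDefined (F G : Series Y) : Prop :=
  ∀ Γ : UTGraph Empty, {p : UTGraph Y × UTGraph Y |
    F p.1 ≠ 0 ∧ G p.2 ≠ 0 ∧ UTGraph.glueCount Γ p.1 p.2 ≠ 0}.Finite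

/-- The gluing pairing `⟨F, G⟩ ∈ 𝒟(∅)`, the bilinear extension of: `⟨g, h⟩` is the sum of all
ways of identifying the univalent vertices of `g` with those of `h`, colour by colour. -/
noncomputable def pairing (F G : Series Y) : Series Empty := fun Γ =>
  ∑ᶠ p : UTGraph Y × UTGraph Y, F p.1 * G p.2 * (UTGraph.glueCount Γ p.1 p.2 : ℚ)

end Series

end UniTri

/-! The natural quantity is not the coefficient of a graph but that coefficient times the number of
automorphisms of the graph (`Series.weighted`). For a concrete diagram `g`, the isomorphisms from a
disjoint union of two graphs onto `g` correspond to a choice of a union of components of `g` (a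
`Split`) together with isomorphisms onto that part and onto its complement. Counting them
(`aut_eq_sum`) removes all symmetry factors: the weight of a product of series at `g` is the sum,
over all splits of `g`, of the products of the weights of the two parts (`weighted_mul`).

In this form exponentials of primitive series are recognisable. The weight of `exp B` is
multiplicative under disjoint union: the weights of `exp(tB)` are polynomials in `t` that satisfy
`d/dt exp(tB) = B exp(tB)`, and a primitive `B` has weight zero on a union of two non-empty graphs,
so both sides of the product formula satisfy the same recursion (`divPowPoly_union`). Conversely, a
series with coefficient one at the empty graph and multiplicative weights is determined by its
values on connected graphs, hence is the exponential of its primitive part (`eq_exp_primitivePart`).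

It remains to see that pairing preserves multiplicativity (`weighted_pairing_union`). A splitting of
a glued diagram is the same thing as a pair of splittings of the two diagrams that the matching
respects, and such a matching consists of independent matchings of the two parts
(`sum_matching_sum_split`).

For the existence of the pairing, a diagram without struts has at most as many univalent vertices as
half-edges at trivalent vertices. The latter are visible in the glued graph, and the matching
carries the bound over to the other factor. The numbers of edges are then bounded as well, so only
finitely many pairs of graphs remain. -/

namespace UniTri
variable {Y : Type u}

/-! ### Unions of components, restriction, and isomorphisms from a disjoint union -/

namespace Diagram

/-- A union of components of `g`, given by its edges. -/
def Split (g : Diagram Y) : Type :=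
  {P : Set g.E // ∀ t, g.inc (Sum.inl (g.rot t)) ∈ P ↔ g.inc (Sum.inl t) ∈ P}

instance (g : Diagram Y) : Finite g.Split := inferInstanceAs (Finite (Subtype _))

namespace Split

variable {g h : Diagram Y}

@[ext] theorem ext {P Q : g.Split} (hPQ : ∀ e, e ∈ P.1 ↔ e ∈ Q.1) : P = Q :=
  Subtype.ext (Set.ext hPQ)

/-- The remaining components. -/
def compl (P : g.Split) : g.Split := ⟨P.1ᶜ, fun t => not_congr (P.2 t)⟩

/-- No component. -/
def bot (g : Diagram Y) : g.Split := ⟨∅, fun _ => Iff.rfl⟩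

/-- All components. -/
def top (g : Diagram Y) : g.Split := ⟨Set.univ, fun _ => Iff.rfl⟩

theorem compl_bot : (bot g).compl = top g := Subtype.ext Set.compl_empty

theorem compl_top : (top g).compl = bot g := Subtype.ext Set.compl_univ

theorem mem_iff_of_eqvGen (P : g.Split) {e e' : g.E} (he : Relation.EqvGen g.EdgeAdj e e') :
    e ∈ P.1 ↔ e' ∈ P.1 := by
  induction he with
  | rel x y hxy =>
    obtain ⟨t, rfl, rfl⟩ := hxy
    exact (P.2 t).symm
  | refl x => exact Iff.rfl
  | symm x y _ ih => exact ih.symm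
  | trans x y z _ _ ih1 ih2 => exact ih1.trans ih2

/-- The component of an edge. -/
def component (e : g.E) : g.Split :=
  ⟨{e' | Relation.EqvGen g.EdgeAdj e e'}, fun t => by
    have ht : Relation.EqvGen g.EdgeAdj (g.inc (Sum.inl t)) (g.inc (Sum.inl (g.rot t))) :=
      Relation.EqvGen.rel _ _ ⟨t, rfl, rfl⟩
    exact ⟨fun h => h.trans _ _ _ ht.symm, fun h => h.trans _ _ _ ht⟩⟩

theorem eq_bot_or_eq_top (hg : g.Connected) (P : g.Split) : P = bot g ∨ P = top g := by
  by_cases hP : ∃ e, e ∈ P.1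
  · obtain ⟨e, he⟩ := hP
    right
    ext e'
    exact ⟨fun _ => trivial, fun _ => (P.mem_iff_of_eqvGen (hg.2 e e')).1 he⟩
  · left
    ext e
    exact ⟨fun he => hP ⟨e, he⟩, fun he => he.elim⟩

theorem bot_ne_top (hg : g.Connected) : bot g ≠ top g := by
  intro hh
  obtain ⟨e⟩ := hg.1
  have : e ∈ (bot g).1 := by
    rw [hh]
    trivial
  exact this

/-- Otherwise the component of every edge would contain all edges. -/
theorem exists_proper [Nonempty g.E] (hg : ¬ g.Connected) :
    ∃ P : g.Split, (∃ e, e ∈ P.1) ∧ ∃ e, e ∉ P.1 := by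
  by_contra! hh
  exact hg ⟨inferInstance, fun e e' => hh (component e) ⟨e, Relation.EqvGen.refl e⟩ e'⟩

/-- Splits are carried along by isomorphisms. -/
def map (f : Iso g h) (P : g.Split) : h.Split :=
  ⟨f.eE.symm ⁻¹' P.1, fun t => by
    have h1 := f.symm.inc_comm (Sum.inl (h.rot t))
    have h2 := f.symm.inc_comm (Sum.inl t)
    have h3 := f.symm.rot_comm t
    simp only [Sum.map_inl] at h1 h2
    rw [← h3] at h1
    have h1' : g.inc (Sum.inl (g.rot (f.symm.eT t))) = f.eE.symm (h.inc (Sum.inl (h.rot t))) := h1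
    have h2' : g.inc (Sum.inl (f.symm.eT t)) = f.eE.symm (h.inc (Sum.inl t)) := h2
    rw [Set.mem_preimage, Set.mem_preimage, ← h1', ← h2']
    exact P.2 _⟩

/-- The left part of a disjoint union. -/
def left (g h : Diagram Y) : (g.union h).Split :=
  ⟨{e | e.isLeft}, by rintro (t | t) <;> exact Iff.rfl⟩

end Split

/-- The diagram consisting of some of the components of `g`. -/
def restrict (g : Diagram Y) (P : g.Split) : Diagram Y where
  T := {t : g.T // g.inc (Sum.inl t) ∈ P.1}
  L := {l : g.L // g.inc (Sum.inr l) ∈ P.1}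
  E := {e : g.E // e ∈ P.1}
  finT := inferInstance
  finL := inferInstance
  finE := inferInstance
  rot := g.rot.subtypePerm P.2
  rot_ne t := fun h => g.rot_ne t.1 (congrArg Subtype.val h)
  rot_rot_rot t := Subtype.ext (g.rot_rot_rot t.1)
  col l := g.col l.1
  inc := Sum.elim (fun t => ⟨g.inc (Sum.inl t.1), t.2⟩) (fun l => ⟨g.inc (Sum.inr l.1), l.2⟩)
  twoEnded := by
    intro e
    have hs : (Sum.map Subtype.val Subtype.val : {t : g.T // g.inc (Sum.inl t) ∈ P.1} ⊕
        {l : g.L // g.inc (Sum.inr l) ∈ P.1} → g.T ⊕ g.L) ''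
        ((Sum.elim (fun t => ⟨g.inc (Sum.inl t.1), t.2⟩) (fun l => ⟨g.inc (Sum.inr l.1), l.2⟩) :
          {t : g.T // g.inc (Sum.inl t) ∈ P.1} ⊕ {l : g.L // g.inc (Sum.inr l) ∈ P.1} →
          {e : g.E // e ∈ P.1}) ⁻¹' {e}) = g.inc ⁻¹' {e.1} := by
      ext x
      constructor
      · rintro ⟨y | y, hy, rfl⟩
        · exact congrArg Subtype.val hy
        · exact congrArg Subtype.val hy
      · intro hx
        have hx : g.inc x = e.1 := hx
        rcases x with x | x
        · exact ⟨Sum.inl ⟨x, hx ▸ e.2⟩, Subtype.ext hx, rfl⟩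
        · exact ⟨Sum.inr ⟨x, hx ▸ e.2⟩, Subtype.ext hx, rfl⟩
    have := g.twoEnded e.1
    rwa [← hs, Set.ncard_image_of_injective _
      (Sum.map_injective.2 ⟨Subtype.val_injective, Subtype.val_injective⟩)] at this

/-- An embedding of `g` onto some components of `h`. -/
structure Emb (g h : Diagram Y) (P : h.Split) where
  T : g.T → h.T
  L : g.L → h.L
  E : g.E → h.E
  injT : Function.Injective T
  injL : Function.Injective L
  injE : Function.Injective E
  memE : ∀ e, E e ∈ P.1
  surjT : ∀ t, h.inc (Sum.inl t) ∈ P.1 → ∃ t', T t' = t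
  surjL : ∀ l, h.inc (Sum.inr l) ∈ P.1 → ∃ l', L l' = l
  surjE : ∀ e ∈ P.1, ∃ e', E e' = e
  rot_comm : ∀ t, h.rot (T t) = T (g.rot t)
  col_comm : ∀ l, h.col (L l) = g.col l
  incT_comm : ∀ t, h.inc (Sum.inl (T t)) = E (g.inc (Sum.inl t))
  incL_comm : ∀ l, h.inc (Sum.inr (L l)) = E (g.inc (Sum.inr l))

/-- An embedding is an isomorphism onto a restriction. -/
noncomputable def Emb.iso {g h : Diagram Y} {P : h.Split} (f : Emb g h P) :
    Iso g (h.restrict P) where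
  eT := Equiv.ofBijective (fun t => (⟨f.T t, by rw [f.incT_comm]; exact f.memE _⟩ :
      {t : h.T // h.inc (Sum.inl t) ∈ P.1}))
    ⟨fun _ _ hab => f.injT (congrArg Subtype.val hab), fun t => by
      obtain ⟨t', ht'⟩ := f.surjT t.1 t.2
      exact ⟨t', Subtype.ext ht'⟩⟩
  eL := Equiv.ofBijective (fun l => (⟨f.L l, by rw [f.incL_comm]; exact f.memE _⟩ :
      {l : h.L // h.inc (Sum.inr l) ∈ P.1}))
    ⟨fun _ _ hab => f.injL (congrArg Subtype.val hab), fun l => by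
      obtain ⟨l', hl'⟩ := f.surjL l.1 l.2
      exact ⟨l', Subtype.ext hl'⟩⟩
  eE := Equiv.ofBijective (fun e => (⟨f.E e, f.memE e⟩ : {e : h.E // e ∈ P.1}))
    ⟨fun _ _ hab => f.injE (congrArg Subtype.val hab), fun e => by
      obtain ⟨e', he'⟩ := f.surjE e.1 e.2
      exact ⟨e', Subtype.ext he'⟩⟩
  rot_comm t := Subtype.ext (f.rot_comm t)
  col_comm l := f.col_comm l
  inc_comm x := by
    rcases x with x | x
    · exact Subtype.ext (f.incT_comm x)
    · exact Subtype.ext (f.incL_comm x)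

namespace Iso

variable {g h g₁ g₂ : Diagram Y}

@[ext] theorem ext {f f' : Iso g h} (hT : ∀ t, f.eT t = f'.eT t) (hL : ∀ l, f.eL l = f'.eL l)
    (hE : ∀ e, f.eE e = f'.eE e) : f = f' := by
  obtain ⟨T, L, E, _, _, _⟩ := f
  obtain ⟨T', L', E', _, _, _⟩ := f'
  obtain rfl : T = T' := Equiv.ext hT
  obtain rfl : L = L' := Equiv.ext hL
  obtain rfl : E = E' := Equiv.ext hE
  rfl

instance : Finite (Iso g h) :=
  Finite.of_injective (fun f : Iso g h => (f.eT, f.eL, f.eE)) (by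
    intro f f' hh
    simp only [Prod.mk.injEq] at hh
    exact Iso.ext (fun t => by rw [hh.1]) (fun t => by rw [hh.2.1]) (fun t => by rw [hh.2.2]))

/-- The left part of a disjoint union, as an embedding. -/
def embLeft (g h : Diagram Y) : Emb g (g.union h) (Split.left g h) where
  T := Sum.inl
  L := Sum.inl
  E := Sum.inl
  injT := Sum.inl_injective
  injL := Sum.inl_injective
  injE := Sum.inl_injective
  memE _ := rfl
  surjT := by
    rintro (t | t) ht
    · exact ⟨t, rfl⟩
    · exact absurd ht Bool.false_ne_true
  surjL := by
    rintro (t | t) ht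
    · exact ⟨t, rfl⟩
    · exact absurd ht Bool.false_ne_true
  surjE := by
    rintro (t | t) ht
    · exact ⟨t, rfl⟩
    · exact absurd ht Bool.false_ne_true
  rot_comm _ := rfl
  col_comm _ := rfl
  incT_comm _ := rfl
  incL_comm _ := rfl

/-- The right part of a disjoint union, as an embedding. -/
def embRight (g h : Diagram Y) : Emb h (g.union h) (Split.left g h).compl where
  T := Sum.inr
  L := Sum.inr
  E := Sum.inr
  injT := Sum.inr_injective
  injL := Sum.inr_injective
  injE := Sum.inr_injective
  memE _ := Bool.false_ne_true
  surjT := by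
    rintro (t | t) ht
    · exact absurd rfl ht
    · exact ⟨t, rfl⟩
  surjL := by
    rintro (t | t) ht
    · exact absurd rfl ht
    · exact ⟨t, rfl⟩
  surjE := by
    rintro (t | t) ht
    · exact absurd rfl ht
    · exact ⟨t, rfl⟩
  rot_comm _ := rfl
  col_comm _ := rfl
  incT_comm _ := rfl
  incL_comm _ := rfl

/-- The composition of an embedding with an isomorphism. -/
def embTrans (f : Iso g h) {P : g.Split} (k : Emb g₁ g P) : Emb g₁ h (P.map f) where
  T t := f.eT (k.T t)
  L t := f.eL (k.L t)
  E t := f.eE (k.E t)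
  injT := f.eT.injective.comp k.injT
  injL := f.eL.injective.comp k.injL
  injE := f.eE.injective.comp k.injE
  memE e := by
    change f.eE.symm (f.eE (k.E e)) ∈ P.1
    rw [Equiv.symm_apply_apply]
    exact k.memE e
  surjT t ht := by
    have h2 : g.inc (Sum.inl (f.eT.symm t)) = f.eE.symm (h.inc (Sum.inl t)) :=
      f.symm.inc_comm (Sum.inl t)
    obtain ⟨t', ht'⟩ := k.surjT (f.eT.symm t) (h2 ▸ ht)
    exact ⟨t', by rw [ht', Equiv.apply_symm_apply]⟩
  surjL t ht := by
    have h2 : g.inc (Sum.inr (f.eL.symm t)) = f.eE.symm (h.inc (Sum.inr t)) :=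
      f.symm.inc_comm (Sum.inr t)
    obtain ⟨t', ht'⟩ := k.surjL (f.eL.symm t) (h2 ▸ ht)
    exact ⟨t', by rw [ht', Equiv.apply_symm_apply]⟩
  surjE e he := by
    obtain ⟨e', he'⟩ := k.surjE (f.eE.symm e) he
    exact ⟨e', by rw [he', Equiv.apply_symm_apply]⟩
  rot_comm t := by rw [f.rot_comm, k.rot_comm]
  col_comm l := by rw [f.col_comm, k.col_comm]
  incT_comm t := by
    rw [← k.incT_comm]
    exact f.inc_comm (Sum.inl (k.T t))
  incL_comm t := by
    rw [← k.incL_comm]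
    exact f.inc_comm (Sum.inr (k.L t))

/-- Isomorphisms onto two complementary restrictions make up an isomorphism from the union. -/
noncomputable def glueSplit (P : g.Split) (u : Iso g₁ (g.restrict P))
    (v : Iso g₂ (g.restrict P.compl)) : Iso (g₁.union g₂) g where
  eT := Equiv.ofBijective (Sum.elim (fun t => (u.eT t).1) (fun t => (v.eT t).1)) (by
    constructor
    · rintro (a | a) (b | b) hab
      · exact congrArg Sum.inl (u.eT.injective (Subtype.ext hab))
      · have hab : (u.eT a).1 = (v.eT b).1 := hab
        exact absurd (hab ▸ (u.eT a).2) (v.eT b).2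
      · have hab : (v.eT a).1 = (u.eT b).1 := hab
        exact absurd (hab ▸ (u.eT b).2) (v.eT a).2
      · exact congrArg Sum.inr (v.eT.injective (Subtype.ext hab))
    · intro t
      by_cases ht : g.inc (Sum.inl t) ∈ P.1
      · obtain ⟨t', ht'⟩ := u.eT.surjective ⟨t, ht⟩
        exact ⟨Sum.inl t', congrArg Subtype.val ht'⟩
      · obtain ⟨t', ht'⟩ := v.eT.surjective ⟨t, ht⟩
        exact ⟨Sum.inr t', congrArg Subtype.val ht'⟩)
  eL := Equiv.ofBijective (Sum.elim (fun t => (u.eL t).1) (fun t => (v.eL t).1)) (by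
    constructor
    · rintro (a | a) (b | b) hab
      · exact congrArg Sum.inl (u.eL.injective (Subtype.ext hab))
      · have hab : (u.eL a).1 = (v.eL b).1 := hab
        exact absurd (hab ▸ (u.eL a).2) (v.eL b).2
      · have hab : (v.eL a).1 = (u.eL b).1 := hab
        exact absurd (hab ▸ (u.eL b).2) (v.eL a).2
      · exact congrArg Sum.inr (v.eL.injective (Subtype.ext hab))
    · intro t
      by_cases ht : g.inc (Sum.inr t) ∈ P.1
      · obtain ⟨t', ht'⟩ := u.eL.surjective ⟨t, ht⟩
        exact ⟨Sum.inl t', congrArg Subtype.val ht'⟩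
      · obtain ⟨t', ht'⟩ := v.eL.surjective ⟨t, ht⟩
        exact ⟨Sum.inr t', congrArg Subtype.val ht'⟩)
  eE := Equiv.ofBijective (Sum.elim (fun t => (u.eE t).1) (fun t => (v.eE t).1)) (by
    constructor
    · rintro (a | a) (b | b) hab
      · exact congrArg Sum.inl (u.eE.injective (Subtype.ext hab))
      · have hab : (u.eE a).1 = (v.eE b).1 := hab
        exact absurd (hab ▸ (u.eE a).2) (v.eE b).2
      · have hab : (v.eE a).1 = (u.eE b).1 := hab
        exact absurd (hab ▸ (u.eE b).2) (v.eE a).2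
      · exact congrArg Sum.inr (v.eE.injective (Subtype.ext hab))
    · intro t
      by_cases ht : t ∈ P.1
      · obtain ⟨t', ht'⟩ := u.eE.surjective ⟨t, ht⟩
        exact ⟨Sum.inl t', congrArg Subtype.val ht'⟩
      · obtain ⟨t', ht'⟩ := v.eE.surjective ⟨t, ht⟩
        exact ⟨Sum.inr t', congrArg Subtype.val ht'⟩)
  rot_comm := by
    rintro (t | t)
    · exact congrArg Subtype.val (u.rot_comm t)
    · exact congrArg Subtype.val (v.rot_comm t)
  col_comm := by
    rintro (l | l)
    · exact u.col_comm l
    · exact v.col_comm l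
  inc_comm := by
    rintro ((t | t) | (t | t))
    · exact congrArg Subtype.val (u.inc_comm (Sum.inl t))
    · exact congrArg Subtype.val (v.inc_comm (Sum.inl t))
    · exact congrArg Subtype.val (u.inc_comm (Sum.inr t))
    · exact congrArg Subtype.val (v.inc_comm (Sum.inr t))

/-- The split is recovered from the assembled isomorphism as the image of the left summand; this
gives injectivity in `glueSplit_bijective`. -/
theorem mem_iff_glueSplit (P : g.Split) (u : Iso g₁ (g.restrict P))
    (v : Iso g₂ (g.restrict P.compl)) (e : g.E) :
    e ∈ P.1 ↔ ∃ e', (glueSplit P u v).eE (Sum.inl e') = e := by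
  constructor
  · intro he
    obtain ⟨e', he'⟩ := u.eE.surjective ⟨e, he⟩
    exact ⟨e', congrArg Subtype.val he'⟩
  · rintro ⟨e', rfl⟩
    exact (u.eE e').2

/-- The bijection behind all symmetry factors. An isomorphism from a union comes from the split
formed by the image of the left summand, with its restrictions to the two summands. -/
theorem glueSplit_bijective (g₁ g₂ g : Diagram Y) : Function.Bijective
    (fun x : (P : g.Split) × (Iso g₁ (g.restrict P) × Iso g₂ (g.restrict P.compl)) =>
      glueSplit x.1 x.2.1 x.2.2) := by
  constructor
  · rintro ⟨P, u, v⟩ ⟨P', u', v'⟩ hh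
    have hh : glueSplit P u v = glueSplit P' u' v' := hh
    obtain rfl : P = P' := by
      ext e
      rw [mem_iff_glueSplit P u v, mem_iff_glueSplit P' u' v', hh]
    have hu : u = u' := Iso.ext
      (fun t => Subtype.ext (congrArg (fun f : Iso (g₁.union g₂) g => f.eT (Sum.inl t)) hh))
      (fun t => Subtype.ext (congrArg (fun f : Iso (g₁.union g₂) g => f.eL (Sum.inl t)) hh))
      (fun t => Subtype.ext (congrArg (fun f : Iso (g₁.union g₂) g => f.eE (Sum.inl t)) hh))
    have hv : v = v' := Iso.ext
      (fun t => Subtype.ext (congrArg (fun f : Iso (g₁.union g₂) g => f.eT (Sum.inr t)) hh))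
      (fun t => Subtype.ext (congrArg (fun f : Iso (g₁.union g₂) g => f.eL (Sum.inr t)) hh))
      (fun t => Subtype.ext (congrArg (fun f : Iso (g₁.union g₂) g => f.eE (Sum.inr t)) hh))
    rw [hu, hv]
  · intro f
    refine ⟨⟨(Split.left g₁ g₂).map f, (f.embTrans (embLeft g₁ g₂)).iso,
      (f.embTrans (embRight g₁ g₂)).iso⟩, ?_⟩
    ext (t | t) <;> rfl

end Iso

end Diagram

open Diagram

/-! ### Automorphism numbers and decompositions of a graph -/

namespace UTGraph

theorem mk_eq_mk {g h : Diagram Y} : mk g = mk h ↔ Nonempty (Iso g h) :=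
  ⟨fun hh => Quotient.exact hh, fun hh => Quotient.sound hh⟩

theorem mk_union (g h : Diagram Y) : mk (g.union h) = (mk g).union (mk h) := rfl

theorem exists_mk (x : UTGraph Y) : ∃ g, mk g = x := Quotient.exists_rep x

theorem mk_union_restrict (g : Diagram Y) (P : g.Split) :
    (mk (g.restrict P)).union (mk (g.restrict P.compl)) = mk g :=
  mk_eq_mk.2 ⟨Iso.glueSplit P (Iso.refl _) (Iso.refl _)⟩

/-- The number of automorphisms. -/
noncomputable def aut : UTGraph Y → ℕ :=
  Quotient.lift (fun g : Diagram Y => Nat.card (Iso g g)) fun g h ⟨f⟩ =>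
    Nat.card_congr
      { toFun := fun k => (f.symm.trans k).trans f
        invFun := fun k => (f.trans k).trans f.symm
        left_inv := fun k => by ext <;> simp [Iso.trans, Iso.symm]
        right_inv := fun k => by ext <;> simp [Iso.trans, Iso.symm] }

theorem aut_ne_zero (x : UTGraph Y) : (aut x : ℚ) ≠ 0 := by
  obtain ⟨g, rfl⟩ := exists_mk x
  have : Nonempty (Iso g g) := ⟨Iso.refl g⟩
  have : 0 < Nat.card (Iso g g) := Nat.card_pos
  exact_mod_cast this.ne'

theorem aut_mk_of_iso {g h : Diagram Y} (f : Iso g h) : aut (mk g) = Nat.card (Iso g h) :=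
  Nat.card_congr
    { toFun := fun k => k.trans f
      invFun := fun k => k.trans f.symm
      left_inv := fun k => by ext <;> simp [Iso.trans, Iso.symm]
      right_inv := fun k => by ext <;> simp [Iso.trans, Iso.symm] }

open Classical in
theorem card_iso (g h : Diagram Y) :
    Nat.card (Iso g h) = if mk h = mk g then aut (mk g) else 0 := by
  split_ifs with hh
  · obtain ⟨f⟩ := mk_eq_mk.1 hh.symm
    rw [aut_mk_of_iso f]
  · have : IsEmpty (Iso g h) := ⟨fun f => hh (mk_eq_mk.2 ⟨f⟩).symm⟩
    exact Nat.card_of_isEmpty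

/-- The decompositions of a graph into two graphs. -/
abbrev Decomp (x : UTGraph Y) : Type (max 1 u) :=
  {p : UTGraph Y × UTGraph Y // p.1.union p.2 = x}

/-- The decomposition given by a split. -/
def decompOfSplit (g : Diagram Y) (P : g.Split) : Decomp (mk g) :=
  ⟨(mk (g.restrict P), mk (g.restrict P.compl)), mk_union_restrict g P⟩

-- Composition with a fixed isomorphism turns automorphisms of `g` into isomorphisms from the union
-- of the two parts of `p` to `g`, and these are sorted by the split they induce. So the number of
-- splits that realise `p` is `aut (mk g)` divided by the product of the automorphism numbers of the
-- parts.
open Classical in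
theorem aut_eq_sum {g : Diagram Y} [Fintype g.Split] (p : Decomp (mk g)) :
    aut (mk g) = ∑ P : g.Split,
      if decompOfSplit g P = p then aut p.1.1 * aut p.1.2 else 0 := by
  obtain ⟨⟨x, y⟩, hp⟩ := p
  obtain ⟨g₁, rfl⟩ := exists_mk x
  obtain ⟨g₂, rfl⟩ := exists_mk y
  have hp' : mk (g₁.union g₂) = mk g := hp
  obtain ⟨f⟩ := mk_eq_mk.1 hp'
  have hf : aut (mk g) = Nat.card (Iso (g₁.union g₂) g) := by rw [← hp', aut_mk_of_iso f]
  rw [hf, ← Nat.card_congr (Equiv.ofBijective _ (Iso.glueSplit_bijective g₁ g₂ g)),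
    Nat.card_sigma]
  refine Finset.sum_congr rfl fun P _ => ?_
  rw [Nat.card_prod, card_iso, card_iso]
  simp only [decompOfSplit, Subtype.mk.injEq, Prod.mk.injEq]
  split_ifs <;> simp_all

/-- A decomposition realised by no split would make the sum in `aut_eq_sum` vanish, but automorphism
numbers are positive. Since a diagram has finitely many splits, the sums that define products of
series are finite. -/
theorem decompOfSplit_surjective (g : Diagram Y) : Function.Surjective (decompOfSplit g) := by
  classical
  intro p
  have := Fintype.ofFinite g.Split
  by_contra! hh
  have h1 := aut_eq_sum p
  rw [Finset.sum_eq_zero (fun P _ => if_neg (hh P))] at h1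
  exact aut_ne_zero (mk g) (by exact_mod_cast h1)

instance (x : UTGraph Y) : Finite (Decomp x) := by
  obtain ⟨g, rfl⟩ := exists_mk x
  exact Finite.of_surjective _ (decompOfSplit_surjective g)

/-- The passage from isomorphism classes to a concrete diagram: `aut_eq_sum` is inserted for each
decomposition and the two sums are exchanged, so that each split selects exactly one decomposition.
-/
theorem aut_mul_sum_decomp (g : Diagram Y) [Fintype g.Split] [Fintype (Decomp (mk g))]
    (f : UTGraph Y → UTGraph Y → ℚ) :
    (aut (mk g) : ℚ) * ∑ p : Decomp (mk g), f p.1.1 p.1.2 =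
      ∑ P : g.Split, aut (mk (g.restrict P)) * aut (mk (g.restrict P.compl)) *
        f (mk (g.restrict P)) (mk (g.restrict P.compl)) := by
  classical
  rw [Finset.mul_sum]
  have h1 : ∀ p : Decomp (mk g), (aut (mk g) : ℚ) * f p.1.1 p.1.2 =
      ∑ P : g.Split, if decompOfSplit g P = p then
        (aut p.1.1 * aut p.1.2 : ℚ) * f p.1.1 p.1.2 else 0 := by
    intro p
    rw [aut_eq_sum p]
    push_cast
    rw [Finset.sum_mul]
    refine Finset.sum_congr rfl fun P _ => ?_
    split_ifs <;> simp
  rw [Finset.sum_congr rfl fun p _ => h1 p, Finset.sum_comm]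
  refine Finset.sum_congr rfl fun P _ => ?_
  rw [Finset.sum_ite_eq]
  simp [decompOfSplit]

end UTGraph

/-! ### The empty diagram, splits of disjoint unions, induction over graphs -/

namespace Diagram

/-- All components together form the whole diagram. -/
def embTop (g : Diagram Y) : Emb g g (Split.top g) where
  T := id
  L := id
  E := id
  injT := Function.injective_id
  injL := Function.injective_id
  injE := Function.injective_id
  memE _ := trivial
  surjT t _ := ⟨t, rfl⟩
  surjL t _ := ⟨t, rfl⟩
  surjE t _ := ⟨t, rfl⟩
  rot_comm _ := rfl
  col_comm _ := rfl
  incT_comm _ := rfl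
  incL_comm _ := rfl

/-- A diagram without edges is empty. -/
def isoEmpty (g : Diagram Y) [IsEmpty g.E] : Iso g (Diagram.empty Y) :=
  have : IsEmpty g.T := ⟨fun t => isEmptyElim (g.inc (Sum.inl t))⟩
  have : IsEmpty g.L := ⟨fun t => isEmptyElim (g.inc (Sum.inr t))⟩
  { eT := Equiv.equivOfIsEmpty g.T Empty
    eL := Equiv.equivOfIsEmpty g.L Empty
    eE := Equiv.equivOfIsEmpty g.E Empty
    rot_comm := fun t => isEmptyElim t
    col_comm := fun t => isEmptyElim t
    inc_comm := fun t => isEmptyElim (g.inc t) }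

/-- A split of a disjoint union is a pair of splits. -/
def splitUnionEquiv (g h : Diagram Y) : (g.union h).Split ≃ g.Split × h.Split where
  toFun P := (⟨Sum.inl ⁻¹' P.1, fun t => P.2 (Sum.inl t)⟩,
    ⟨Sum.inr ⁻¹' P.1, fun t => P.2 (Sum.inr t)⟩)
  invFun Q := ⟨{e | Sum.elim (· ∈ Q.1.1) (· ∈ Q.2.1) e}, by
    rintro (t | t)
    · exact Q.1.2 t
    · exact Q.2.2 t⟩
  left_inv P := by
    ext (e | e) <;> exact Iff.rfl
  right_inv Q := rfl

/-- Splits of the two parts of a disjoint union give an embedding. -/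
def embUnion (g h : Diagram Y) (P : (g.union h).Split) :
    Emb ((g.restrict (splitUnionEquiv g h P).1).union (h.restrict (splitUnionEquiv g h P).2))
      (g.union h) P where
  T := Sum.map Subtype.val Subtype.val
  L := Sum.map Subtype.val Subtype.val
  E := Sum.map Subtype.val Subtype.val
  injT := Sum.map_injective.2 ⟨Subtype.val_injective, Subtype.val_injective⟩
  injL := Sum.map_injective.2 ⟨Subtype.val_injective, Subtype.val_injective⟩
  injE := Sum.map_injective.2 ⟨Subtype.val_injective, Subtype.val_injective⟩
  memE := by
    rintro (e | e)
    · exact e.2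
    · exact e.2
  surjT := by
    rintro (t | t) ht
    · exact ⟨Sum.inl ⟨t, ht⟩, rfl⟩
    · exact ⟨Sum.inr ⟨t, ht⟩, rfl⟩
  surjL := by
    rintro (t | t) ht
    · exact ⟨Sum.inl ⟨t, ht⟩, rfl⟩
    · exact ⟨Sum.inr ⟨t, ht⟩, rfl⟩
  surjE := by
    rintro (t | t) ht
    · exact ⟨Sum.inl ⟨t, ht⟩, rfl⟩
    · exact ⟨Sum.inr ⟨t, ht⟩, rfl⟩
  rot_comm := by rintro (t | t) <;> rfl
  col_comm := by rintro (t | t) <;> rfl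
  incT_comm := by rintro (t | t) <;> rfl
  incL_comm := by rintro (t | t) <;> rfl

/-- The left summand is a split, and a connected diagram has only the two trivial splits. -/
theorem isEmpty_or_isEmpty_of_connected_union {g h : Diagram Y} (hc : (g.union h).Connected) :
    IsEmpty g.E ∨ IsEmpty h.E := by
  rcases Split.eq_bot_or_eq_top hc (Split.left g h) with hs | hs
  · refine Or.inl ⟨fun e => ?_⟩
    have : Sum.inl e ∈ (Split.bot (g.union h)).1 := hs ▸ (rfl : Sum.inl e ∈ (Split.left g h).1)
    exact this
  · refine Or.inr ⟨fun e => ?_⟩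
    have : Sum.inr e ∈ (Split.left g h).1 := hs ▸ (trivial : Sum.inr e ∈ (Split.top (g.union h)).1)
    exact Bool.false_ne_true this

end Diagram

namespace UTGraph

theorem mk_restrict_top (g : Diagram Y) : mk (g.restrict (Split.top g)) = mk g :=
  (mk_eq_mk.2 ⟨(embTop g).iso⟩).symm

theorem mk_eq_empty_iff {g : Diagram Y} : mk g = empty Y ↔ IsEmpty g.E := by
  constructor
  · intro hh
    obtain ⟨f⟩ := mk_eq_mk.1 hh
    exact ⟨fun e => (f.eE e).elim⟩
  · intro hh
    exact mk_eq_mk.2 ⟨isoEmpty g⟩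

theorem mk_restrict_eq_empty_iff {g : Diagram Y} {P : g.Split} :
    mk (g.restrict P) = empty Y ↔ P = Split.bot g := by
  rw [mk_eq_empty_iff]
  constructor
  · intro hh
    ext e
    exact ⟨fun he => hh.elim ⟨e, he⟩, fun he => he.elim⟩
  · rintro rfl
    exact ⟨fun e => e.2⟩

theorem mk_restrict_bot (g : Diagram Y) : mk (g.restrict (Split.bot g)) = empty Y :=
  mk_restrict_eq_empty_iff.2 rfl

theorem union_empty (x : UTGraph Y) : x.union (empty Y) = x := by
  obtain ⟨g, rfl⟩ := exists_mk x
  have := mk_union_restrict g (Split.top g)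
  rwa [Split.compl_top, mk_restrict_top, mk_restrict_bot] at this

theorem empty_union (x : UTGraph Y) : (empty Y).union x = x := by
  obtain ⟨g, rfl⟩ := exists_mk x
  have := mk_union_restrict g (Split.bot g)
  rwa [Split.compl_bot, mk_restrict_top, mk_restrict_bot] at this

theorem union_eq_empty_iff {x y : UTGraph Y} :
    x.union y = empty Y ↔ x = empty Y ∧ y = empty Y := by
  obtain ⟨g, rfl⟩ := exists_mk x
  obtain ⟨h, rfl⟩ := exists_mk y
  rw [← mk_union, mk_eq_empty_iff, mk_eq_empty_iff, mk_eq_empty_iff]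
  exact isEmpty_sum

theorem connected_mk {g : Diagram Y} : (mk g).Connected ↔ g.Connected := Iff.rfl

theorem not_connected_empty : ¬ (empty Y).Connected := fun hh => hh.1.elim Empty.elim

theorem eq_empty_or_eq_empty_of_connected_union {x y : UTGraph Y} (h : (x.union y).Connected) :
    x = empty Y ∨ y = empty Y := by
  obtain ⟨g, rfl⟩ := exists_mk x
  obtain ⟨k, rfl⟩ := exists_mk y
  rw [mk_eq_empty_iff, mk_eq_empty_iff]
  exact isEmpty_or_isEmpty_of_connected_union h

theorem mk_restrict_union (g h : Diagram Y) (P : (g.union h).Split) :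
    mk ((g.union h).restrict P) =
      (mk (g.restrict (splitUnionEquiv g h P).1)).union
        (mk (h.restrict (splitUnionEquiv g h P).2)) :=
  (mk_eq_mk.2 ⟨(embUnion g h P).iso⟩).symm

theorem aut_empty : aut (empty Y) = 1 := by
  have : Unique (Iso (Diagram.empty Y) (Diagram.empty Y)) :=
    { default := Iso.refl _
      uniq := fun f => Iso.ext (fun t => t.elim) (fun t => t.elim) (fun t => t.elim) }
  exact Nat.card_unique

/-- The number of edges. -/
noncomputable def edgeCard : UTGraph Y → ℕ :=
  Quotient.lift (fun g : Diagram Y => Nat.card g.E) fun _ _ ⟨f⟩ => Nat.card_congr f.eE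

theorem edgeCard_restrict_lt {g : Diagram Y} {P : g.Split} {e : g.E} (he : e ∉ P.1) :
    edgeCard (mk (g.restrict P)) < edgeCard (mk g) := by
  have := Fintype.ofFinite g.E
  classical
  change Nat.card {e : g.E // e ∈ P.1} < Nat.card g.E
  rw [Nat.card_eq_fintype_card, Nat.card_eq_fintype_card]
  exact Fintype.card_subtype_lt he

/-- Induction over graphs, splitting those which are neither empty nor connected. -/
theorem induction_split {p : UTGraph Y → Prop} (h0 : p (empty Y)) (hc : ∀ x, x.Connected → p x)
    (hu : ∀ x y, p x → p y → p (x.union y)) (x : UTGraph Y) : p x := by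
  induction hn : edgeCard x using Nat.strong_induction_on generalizing x with
  | _ n ih =>
    obtain ⟨g, rfl⟩ := exists_mk x
    rcases isEmpty_or_nonempty g.E with hg | hg
    · rw [mk_eq_empty_iff.2 hg]
      exact h0
    by_cases hgc : g.Connected
    · exact hc _ hgc
    -- The part misses `e'` and its complement misses `e`, so both have fewer edges and the
    -- induction applies to each.
    obtain ⟨P, ⟨e, he⟩, e', he'⟩ := Split.exists_proper hgc
    rw [← mk_union_restrict g P]
    exact hu _ _ (ih _ (hn ▸ edgeCard_restrict_lt he') _ rfl)
      (ih _ (hn ▸ edgeCard_restrict_lt (P := P.compl) (fun h => h he)) _ rfl)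

end UTGraph

/-! ### Weighted coefficients and exponentials of primitive series -/

namespace Series
open UTGraph

/-- The coefficients multiplied by the numbers of automorphisms. -/
noncomputable def weighted (F : Series Y) (x : UTGraph Y) : ℚ := aut x * F x

/-- The reason for the weights: the product becomes a convolution over splits in which no symmetry
factor is left. -/
theorem weighted_mul (F G : Series Y) (g : Diagram Y) [Fintype g.Split] :
    weighted (mul F G) (mk g) =
      ∑ P : g.Split, weighted F (mk (g.restrict P)) * weighted G (mk (g.restrict P.compl)) := by
  have := Fintype.ofFinite (Decomp (mk g))
  rw [weighted, mul, finsum_eq_sum_of_fintype, aut_mul_sum_decomp g (fun x y => F x * G y)]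
  refine Finset.sum_congr rfl fun P _ => ?_
  rw [weighted, weighted]
  ring

theorem exists_ne_zero_of_finsum_ne_zero {X : Type*} {f : X → ℚ} (h : ∑ᶠ x, f x ≠ 0) :
    ∃ x, f x ≠ 0 := by
  by_contra! hf
  exact h (by simp [hf])

theorem mul_ne_zero {F G : Series Y} {x : UTGraph Y} (h : mul F G x ≠ 0) :
    ∃ y z, y.union z = x ∧ F y ≠ 0 ∧ G z ≠ 0 := by
  obtain ⟨⟨p, hp⟩, hne⟩ := exists_ne_zero_of_finsum_ne_zero h
  exact ⟨p.1, p.2, hp, left_ne_zero_of_mul hne, right_ne_zero_of_mul hne⟩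

theorem weighted_one_empty : weighted (one Y) (UTGraph.empty Y) = 1 := by
  rw [weighted, one, if_pos rfl, aut_empty]
  norm_num

theorem weighted_one_of_ne {x : UTGraph Y} (hx : x ≠ UTGraph.empty Y) :
    weighted (one Y) x = 0 := by
  rw [weighted, one, if_neg hx, mul_zero]

theorem weighted_one_union (x y : UTGraph Y) :
    weighted (one Y) (x.union y) = weighted (one Y) x * weighted (one Y) y := by
  by_cases hx : x = UTGraph.empty Y
  · rw [hx, empty_union, weighted_one_empty, one_mul]
  · rw [weighted_one_of_ne hx, zero_mul, weighted_one_of_ne fun h => hx (union_eq_empty_iff.1 h).1]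

section Primitive

variable {B : Series Y}

theorem IsPrimitive.weighted_empty (hB : B.IsPrimitive) : weighted B (UTGraph.empty Y) = 0 := by
  by_contra h
  exact not_connected_empty (hB _ (right_ne_zero_of_mul h))

-- Weights of a primitive series behave like a derivation at the empty graph: only unions with an
-- empty side survive, because a connected graph is not a union of two non-empty ones.
open Classical in
theorem IsPrimitive.weighted_union (hB : B.IsPrimitive) (x y : UTGraph Y) :
    weighted B (x.union y) = (if y = UTGraph.empty Y then weighted B x else 0) +
      (if x = UTGraph.empty Y then weighted B y else 0) := by
  by_cases hx : x = UTGraph.empty Y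
  · subst hx
    rw [empty_union, if_pos rfl, hB.weighted_empty, ite_self, zero_add]
  · rw [if_neg hx, add_zero]
    split_ifs with hy
    · rw [hy, union_empty]
    · by_contra h
      have := eq_empty_or_eq_empty_of_connected_union (hB _ (right_ne_zero_of_mul h))
      tauto

/-- The weighted coefficients of `Fⁿ / n!`. -/
noncomputable def divPow (F : Series Y) (n : ℕ) (x : UTGraph Y) : ℚ :=
  weighted (pow F n) x / n.factorial

theorem divPow_zero (F : Series Y) (x : UTGraph Y) : divPow F 0 x = weighted (one Y) x := by
  simp [divPow, pow]

/-- The coefficientwise form of the differential equation `d/dt exp(tF) = F exp(tF)`. -/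
theorem divPow_succ (F : Series Y) (n : ℕ) (g : Diagram Y) [Fintype g.Split] :
    divPow F (n + 1) (mk g) * (n + 1) =
      ∑ P : g.Split, weighted F (mk (g.restrict P)) * divPow F n (mk (g.restrict P.compl)) := by
  have h1 : ((n.factorial : ℕ) : ℚ) ≠ 0 := by exact_mod_cast n.factorial_ne_zero
  have h2 : (n + 1 : ℚ) ≠ 0 := by exact_mod_cast n.succ_ne_zero
  simp only [divPow, pow]
  rw [weighted_mul, Nat.factorial_succ]
  push_cast
  simp only [← mul_div_assoc]
  rw [← Finset.sum_div]
  field_simp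

/-- Each of the `n` factors is a connected graph and uses up at least one edge. Hence the
exponential series is a finite sum at every graph. -/
theorem IsPrimitive.divPow_eq_zero (hB : B.IsPrimitive) {n : ℕ} {x : UTGraph Y}
    (hn : edgeCard x < n) : divPow B n x = 0 := by
  induction n generalizing x with
  | zero => omega
  | succ n ih =>
    obtain ⟨g, rfl⟩ := exists_mk x
    have := Fintype.ofFinite g.Split
    have h2 : (n + 1 : ℚ) ≠ 0 := by exact_mod_cast n.succ_ne_zero
    rw [← mul_left_inj' h2, divPow_succ, zero_mul]
    refine Finset.sum_eq_zero fun P _ => ?_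
    by_cases hP : weighted B (mk (g.restrict P)) = 0
    · rw [hP, zero_mul]
    · obtain ⟨⟨e⟩, -⟩ := connected_mk.1 (hB _ (right_ne_zero_of_mul hP))
      have := edgeCard_restrict_lt (P := P.compl) (e := e.1) (fun h => h e.2)
      rw [ih (by omega), mul_zero]

open Polynomial in
/-- The polynomial whose coefficients are the weighted coefficients of `Bⁿ / n!`. -/
noncomputable def divPowPoly (B : Series Y) (x : UTGraph Y) : ℚ[X] :=
  ∑ n ∈ Finset.range (edgeCard x + 1), monomial n (divPow B n x)

theorem IsPrimitive.coeff_divPowPoly (hB : B.IsPrimitive) (x : UTGraph Y) (n : ℕ) :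
    (divPowPoly B x).coeff n = divPow B n x := by
  rw [divPowPoly, Polynomial.finsetSum_coeff]
  simp only [Polynomial.coeff_monomial]
  rw [Finset.sum_ite_eq']
  split_ifs with h
  · rfl
  · rw [hB.divPow_eq_zero]
    simpa using h

theorem IsPrimitive.weighted_exp (hB : B.IsPrimitive) (x : UTGraph Y) :
    weighted B.exp x = (divPowPoly B x).eval 1 := by
  rw [divPowPoly, Polynomial.eval_finsetSum, weighted, exp,
    finsum_eq_sum_of_support_subset (s := Finset.range (edgeCard x + 1)), Finset.mul_sum]
  · refine Finset.sum_congr rfl fun n _ => ?_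
    rw [Polynomial.eval_monomial, one_pow, mul_one, divPow, weighted]
    ring
  · intro n hn
    rw [Finset.coe_range, Set.mem_Iio]
    by_contra! h
    have := hB.divPow_eq_zero (n := n) (x := x) (by omega)
    rw [divPow, weighted, div_eq_zero_iff, mul_eq_zero] at this
    rcases this with (h1 | h1) | h1
    · exact aut_ne_zero x h1
    · exact hn (by simp [h1])
    · exact hn (by simp [h1])

/-- The polynomials are the weights of `exp(tB)`. Both sides have the same constant term, and their
derivatives agree by the Leibniz rule and the derivation property of `B`; coefficients are compared
by induction on the degree, for all pairs of graphs at once. -/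
theorem IsPrimitive.divPowPoly_union (hB : B.IsPrimitive) (x y : UTGraph Y) :
    divPowPoly B (x.union y) = divPowPoly B x * divPowPoly B y := by
  classical
  ext n
  induction n generalizing x y with
  | zero =>
    rw [Polynomial.mul_coeff_zero]
    simp only [hB.coeff_divPowPoly, divPow_zero, weighted_one_union]
  | succ n ih =>
    obtain ⟨g, rfl⟩ := exists_mk x
    obtain ⟨h, rfl⟩ := exists_mk y
    have := Fintype.ofFinite g.Split
    have := Fintype.ofFinite h.Split
    have := Fintype.ofFinite (g.union h).Split
    have h2 : ((n : ℚ) + 1) ≠ 0 := by exact_mod_cast n.succ_ne_zero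
    have deriv : ∀ k : Diagram Y, ∀ [Fintype k.Split], (divPowPoly B (mk k)).derivative =
        ∑ P : k.Split, Polynomial.C (weighted B (mk (k.restrict P))) *
          divPowPoly B (mk (k.restrict P.compl)) := by
      intro k _
      ext m
      rw [Polynomial.coeff_derivative, hB.coeff_divPowPoly, divPow_succ,
        Polynomial.finsetSum_coeff]
      simp only [Polynomial.coeff_C_mul, hB.coeff_divPowPoly]
    -- After multiplication by `n + 1`, the coefficients of degree `n + 1` are those of degree `n`
    -- of the derivatives. A split of the union is then written as a pair of splits.
    rw [← mul_left_inj' h2, ← Polynomial.coeff_derivative, ← Polynomial.coeff_derivative,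
      Polynomial.derivative_mul, ← mk_union, deriv, deriv, deriv,
      ← (splitUnionEquiv g h).symm.sum_comp, Fintype.sum_prod_type]
    -- The weight of `B` vanishes unless `P` or `Q` is empty; these two cases yield the two terms of
    -- the Leibniz rule.
    have key : ∀ (P : g.Split) (Q : h.Split), (Polynomial.C (weighted B (mk ((g.union h).restrict
          ((splitUnionEquiv g h).symm (P, Q))))) * divPowPoly B (mk ((g.union h).restrict
          ((splitUnionEquiv g h).symm (P, Q)).compl))).coeff n =
        (if Q = Split.bot h then (Polynomial.C (weighted B (mk (g.restrict P))) *
          divPowPoly B (mk (g.restrict P.compl)) * divPowPoly B (mk h)).coeff n else 0) +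
        (if P = Split.bot g then (divPowPoly B (mk g) *
          (Polynomial.C (weighted B (mk (h.restrict Q))) *
          divPowPoly B (mk (h.restrict Q.compl)))).coeff n else 0) := by
      intro P Q
      have e1 : mk ((g.union h).restrict ((splitUnionEquiv g h).symm (P, Q))) =
        (mk (g.restrict P)).union (mk (h.restrict Q)) := mk_restrict_union g h _
      have e2 : mk ((g.union h).restrict ((splitUnionEquiv g h).symm (P, Q)).compl) =
        (mk (g.restrict P.compl)).union (mk (h.restrict Q.compl)) := mk_restrict_union g h _
      rw [Polynomial.coeff_C_mul, e1, e2, ih, hB.weighted_union, mk_restrict_eq_empty_iff,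
        mk_restrict_eq_empty_iff, add_mul]
      congr 1
      · split_ifs with hQ
        · rw [hQ, Split.compl_bot, mk_restrict_top, mul_assoc, Polynomial.coeff_C_mul]
        · rw [zero_mul]
      · split_ifs with hP
        · rw [hP, Split.compl_bot, mk_restrict_top, mul_left_comm, Polynomial.coeff_C_mul]
        · rw [zero_mul]
    simp only [Polynomial.coeff_add, Polynomial.finsetSum_coeff, Finset.sum_mul,
      Finset.mul_sum, key, Finset.sum_add_distrib]
    congr 1
    · simp
    · rw [Finset.sum_comm]
      simp

theorem IsPrimitive.weighted_exp_union (hB : B.IsPrimitive) (x y : UTGraph Y) :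
    weighted B.exp (x.union y) = weighted B.exp x * weighted B.exp y := by
  rw [hB.weighted_exp, hB.weighted_exp, hB.weighted_exp, hB.divPowPoly_union, Polynomial.eval_mul]

theorem IsPrimitive.exp_empty (hB : B.IsPrimitive) : B.exp (UTGraph.empty Y) = 1 := by
  have h0 : edgeCard (UTGraph.empty Y) = 0 := Nat.card_of_isEmpty (α := Empty)
  have := hB.weighted_exp (UTGraph.empty Y)
  rw [divPowPoly, h0] at this
  simpa [weighted, divPow_zero, aut_empty, one] using this

/-- A connected graph has only the two trivial splits, so only the linear term of the exponential
reaches it. -/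
theorem IsPrimitive.exp_of_connected (hB : B.IsPrimitive) {x : UTGraph Y} (hx : x.Connected) :
    B.exp x = B x := by
  classical
  obtain ⟨g, rfl⟩ := exists_mk x
  have hg : g.Connected := hx
  have := Fintype.ofFinite g.Split
  have h0 : edgeCard (UTGraph.empty Y) = 0 := Nat.card_of_isEmpty (α := Empty)
  have hne : mk g ≠ UTGraph.empty Y := fun h => not_connected_empty (h ▸ hx)
  have hp : divPowPoly B (mk g) = Polynomial.C (weighted B (mk g)) * Polynomial.X := by
    ext n
    rw [hB.coeff_divPowPoly]
    cases n with
    | zero => rw [divPow_zero, weighted_one_of_ne hne]; simp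
    | succ n =>
      have h2 : ((n : ℚ) + 1) ≠ 0 := by exact_mod_cast n.succ_ne_zero
      have hu : (Finset.univ : Finset g.Split) = {Split.bot g, Split.top g} := by
        ext P
        simpa using Split.eq_bot_or_eq_top hg P
      rw [← mul_left_inj' h2, divPow_succ, hu, Finset.sum_pair (Split.bot_ne_top hg),
        mk_restrict_bot, hB.weighted_empty, zero_mul, zero_add, Split.compl_top, mk_restrict_top,
        mk_restrict_bot, Polynomial.coeff_C_mul, Polynomial.coeff_X]
      cases n with
      | zero => simp [divPow_zero, weighted_one_empty]
      | succ n => rw [hB.divPow_eq_zero (by omega)]; simp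
  have h := hB.weighted_exp (mk g)
  rw [hp] at h
  simp only [Polynomial.eval_mul, Polynomial.eval_C, Polynomial.eval_X, mul_one] at h
  exact mul_left_cancel₀ (aut_ne_zero _) h

end Primitive

theorem primitivePart_isPrimitive (F : Series Y) : F.primitivePart.IsPrimitive := by
  intro x hx
  by_contra h
  exact hx (if_neg h)

/-- A series with multiplicative weighted coefficients is the exponential of its primitive
part. -/
theorem eq_exp_primitivePart {F : Series Y} (h0 : F (UTGraph.empty Y) = 1)
    (hF : ∀ x y, weighted F (x.union y) = weighted F x * weighted F y) :
    F = F.primitivePart.exp := by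
  have hP := primitivePart_isPrimitive F
  have key : ∀ x, weighted F x = weighted F.primitivePart.exp x := by
    refine induction_split ?_ ?_ ?_
    · rw [weighted, weighted, h0, hP.exp_empty]
    · intro x hx
      rw [weighted, weighted, hP.exp_of_connected hx, primitivePart, if_pos hx]
    · intro x y hx hy
      rw [hF, hP.weighted_exp_union, hx, hy]
  funext x
  exact mul_left_cancel₀ (aut_ne_zero x) (key x)

/-- A property of graphs that fails for the empty graph and is inherited from the parts of a
disjoint union does not occur in `exp F` if it does not occur in `F`. -/
theorem exp_avoids {F : Series Y} {p : UTGraph Y → Prop} (h0 : ¬ p (UTGraph.empty Y))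
    (hu : ∀ x y, p (x.union y) → p x ∨ p y) (hF : ∀ x, F x ≠ 0 → ¬ p x) (x : UTGraph Y)
    (hx : F.exp x ≠ 0) : ¬ p x := by
  obtain ⟨n, hn⟩ := exists_ne_zero_of_finsum_ne_zero hx
  replace hn := right_ne_zero_of_mul hn
  clear hx
  induction n generalizing x with
  | zero =>
    by_cases h : x = UTGraph.empty Y
    · rwa [h]
    · exact absurd (if_neg h) hn
  | succ n ih =>
    obtain ⟨y, z, rfl, hy, hz⟩ := mul_ne_zero hn
    exact fun h => (hu _ _ h).elim (hF _ hy) (ih _ hz)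

end Series

/-! ### Matchings and splits of a glued diagram -/

open Classical in
/-- Two bijections between complementary subtypes make up a bijection. -/
noncomputable def piecewiseEquiv {α β : Type*} {p : α → Prop} {q : β → Prop}
    (e : {a // p a} ≃ {b // q b}) (e' : {a // ¬ p a} ≃ {b // ¬ q b}) : α ≃ β :=
  ((Equiv.sumCompl p).symm.trans (Equiv.sumCongr e e')).trans (Equiv.sumCompl q)

theorem piecewiseEquiv_of_pos {α β : Type*} {p : α → Prop} {q : β → Prop}
    (e : {a // p a} ≃ {b // q b}) (e' : {a // ¬ p a} ≃ {b // ¬ q b}) (a : {a // p a}) :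
    piecewiseEquiv e e' a.1 = (e a).1 := by
  simp [piecewiseEquiv]

theorem piecewiseEquiv_of_neg {α β : Type*} {p : α → Prop} {q : β → Prop}
    (e : {a // p a} ≃ {b // q b}) (e' : {a // ¬ p a} ≃ {b // ¬ q b}) (a : {a // ¬ p a}) :
    piecewiseEquiv e e' a.1 = (e' a).1 := by
  simp [piecewiseEquiv]

namespace Diagram

section Glue

variable {g h : Diagram Y}

instance : Finite (Matching g h) := inferInstanceAs (Finite (Subtype _))

namespace Matching

/-- A matching is compatible with splits if it matches the chosen parts. -/
def Compat (φ : Matching g h) (x : g.Split × h.Split) : Prop :=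
  ∀ l, g.inc (Sum.inr l) ∈ x.1.1 ↔ h.inc (Sum.inr (φ.1 l)) ∈ x.2.1

theorem Compat.compl {φ : Matching g h} {P : g.Split} {Q : h.Split} (hc : φ.Compat (P, Q)) :
    φ.Compat (P.compl, Q.compl) := fun l => not_congr (hc l)

/-- The restriction of a matching to compatible parts. -/
def restrict (φ : Matching g h) {P : g.Split} {Q : h.Split} (hc : φ.Compat (P, Q)) :
    Matching (g.restrict P) (h.restrict Q) :=
  ⟨φ.1.subtypeEquiv hc, fun l => φ.2 l.1⟩

/-- A matching is made up of matchings of two complementary parts. -/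
noncomputable def combine {P : g.Split} {Q : h.Split} (φ : Matching (g.restrict P) (h.restrict Q))
    (ψ : Matching (g.restrict P.compl) (h.restrict Q.compl)) : Matching g h :=
  ⟨piecewiseEquiv φ.1 ψ.1, fun l => by
    by_cases hl : g.inc (Sum.inr l) ∈ P.1
    · exact (congrArg h.col (piecewiseEquiv_of_pos φ.1 ψ.1 ⟨l, hl⟩)).trans (φ.2 ⟨l, hl⟩)
    · exact (congrArg h.col (piecewiseEquiv_of_neg φ.1 ψ.1 ⟨l, hl⟩)).trans (ψ.2 ⟨l, hl⟩)⟩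

theorem combine_of_mem {P : g.Split} {Q : h.Split} (φ : Matching (g.restrict P) (h.restrict Q))
    (ψ : Matching (g.restrict P.compl) (h.restrict Q.compl)) (l : (g.restrict P).L) :
    (combine φ ψ).1 l.1 = (φ.1 l).1 :=
  piecewiseEquiv_of_pos φ.1 ψ.1 l

theorem combine_of_notMem {P : g.Split} {Q : h.Split}
    (φ : Matching (g.restrict P) (h.restrict Q))
    (ψ : Matching (g.restrict P.compl) (h.restrict Q.compl)) (l : (g.restrict P.compl).L) :
    (combine φ ψ).1 l.1 = (ψ.1 l).1 :=
  piecewiseEquiv_of_neg φ.1 ψ.1 l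

theorem combine_compat {P : g.Split} {Q : h.Split}
    (φ : Matching (g.restrict P) (h.restrict Q))
    (ψ : Matching (g.restrict P.compl) (h.restrict Q.compl)) : (combine φ ψ).Compat (P, Q) := by
  intro l
  by_cases hl : g.inc (Sum.inr l) ∈ P.1
  · have := combine_of_mem φ ψ ⟨l, hl⟩
    refine ⟨fun _ => ?_, fun _ => hl⟩
    rw [this]
    exact (φ.1 ⟨l, hl⟩).2
  · have := combine_of_notMem φ ψ ⟨l, hl⟩
    refine ⟨fun h => absurd h hl, fun h' => ?_⟩
    rw [this] at h'
    exact absurd h' (ψ.1 ⟨l, hl⟩).2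

/-- Matchings compatible with given splits are pairs of matchings. -/
noncomputable def compatEquiv (P : g.Split) (Q : h.Split) :
    {φ : Matching g h // φ.Compat (P, Q)} ≃
      Matching (g.restrict P) (h.restrict Q) ×
        Matching (g.restrict P.compl) (h.restrict Q.compl) where
  toFun φ := (φ.1.restrict φ.2, φ.1.restrict φ.2.compl)
  invFun x := ⟨combine x.1 x.2, combine_compat x.1 x.2⟩
  left_inv φ := by
    refine Subtype.ext (Subtype.ext (Equiv.ext fun l => ?_))
    by_cases hl : g.inc (Sum.inr l) ∈ P.1
    · exact combine_of_mem _ _ ⟨l, hl⟩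
    · exact combine_of_notMem _ _ ⟨l, hl⟩
  right_inv x := Prod.ext
    (Subtype.ext (Equiv.ext fun l => Subtype.ext (combine_of_mem x.1 x.2 l)))
    (Subtype.ext (Equiv.ext fun l => Subtype.ext (combine_of_notMem x.1 x.2 l)))

end Matching

variable (φ : Matching g h)

/-- The splits of the two diagrams given by a split of the glued diagram. -/
def splitOfGlue (R : (g.glue h φ).Split) : g.Split × h.Split :=
  (⟨{e | Quot.mk _ (Sum.inl e) ∈ R.1}, fun t => R.2 (Sum.inl t)⟩,
    ⟨{e | Quot.mk _ (Sum.inr e) ∈ R.1}, fun t => R.2 (Sum.inr t)⟩)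

theorem splitOfGlue_compat (R : (g.glue h φ).Split) : φ.Compat (splitOfGlue φ R) := by
  intro l
  change Quot.mk (GlueRel g h φ) _ ∈ R.1 ↔ Quot.mk (GlueRel g h φ) _ ∈ R.1
  rw [Quot.sound (GlueRel.glue l)]

/-- The splits of the glued diagram are the compatible pairs of splits. -/
def splitGlueEquiv : (g.glue h φ).Split ≃ {x : g.Split × h.Split // φ.Compat x} where
  toFun R := ⟨splitOfGlue φ R, splitOfGlue_compat φ R⟩
  invFun x := ⟨{q | Quot.lift (Sum.elim (· ∈ x.1.1.1) (· ∈ x.1.2.1))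
      (by rintro _ _ ⟨l⟩; exact propext (x.2 l)) q}, by
    rintro (t | t)
    · exact x.1.1.2 t
    · exact x.1.2.2 t⟩
  left_inv R := by
    ext q
    obtain ⟨e | e, rfl⟩ := Quot.exists_rep q
    · exact Iff.rfl
    · exact Iff.rfl
  right_inv x := rfl

/-- Gluing parts of the diagrams gives a part of the glued diagram. -/
noncomputable def embGlue (R : (g.glue h φ).Split) {P : g.Split} {Q : h.Split}
    (hP : ∀ e, Quot.mk (GlueRel g h φ) (Sum.inl e) ∈ R.1 ↔ e ∈ P.1)
    (hQ : ∀ e, Quot.mk (GlueRel g h φ) (Sum.inr e) ∈ R.1 ↔ e ∈ Q.1) (hc : φ.Compat (P, Q)) :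
    Emb ((g.restrict P).glue (h.restrict Q) (φ.restrict hc)) (g.glue h φ) R where
  T := Sum.map Subtype.val Subtype.val
  L := id
  E := Quot.map (Sum.map Subtype.val Subtype.val) (by
    rintro _ _ ⟨l⟩
    exact GlueRel.glue l.1)
  injT := Sum.map_injective.2 ⟨Subtype.val_injective, Subtype.val_injective⟩
  injL := Function.injective_id
  injE := by
    classical
    let r := GlueRel (g.restrict P) (h.restrict Q) (φ.restrict hc)
    -- A retraction onto the glued parts, with all other edges sent to `none`. By compatibility,
    -- joined edges lie both inside or both outside the parts, so it descends to the quotient and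
    -- gives a left inverse.
    let k : g.E ⊕ h.E → Option (Quot r) := Sum.elim
      (fun e => if he : e ∈ P.1 then some (Quot.mk r (Sum.inl ⟨e, he⟩)) else none)
      (fun e => if he : e ∈ Q.1 then some (Quot.mk r (Sum.inr ⟨e, he⟩)) else none)
    have hk : ∀ a b, GlueRel g h φ a b → k a = k b := by
      rintro _ _ ⟨l⟩
      by_cases hl : g.inc (Sum.inr l) ∈ P.1
      · have hl' : h.inc (Sum.inr (φ.1 l)) ∈ Q.1 := (hc l).1 hl
        have e1 : k (Sum.inl (g.inc (Sum.inr l))) = some (Quot.mk r (Sum.inl ⟨_, hl⟩)) :=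
          dif_pos hl
        have e2 : k (Sum.inr (h.inc (Sum.inr (φ.1 l)))) = some (Quot.mk r (Sum.inr ⟨_, hl'⟩)) :=
          dif_pos hl'
        rw [e1, e2]
        exact congrArg some (Quot.sound (GlueRel.glue (φ := φ.restrict hc) ⟨l, hl⟩))
      · have hl' : h.inc (Sum.inr (φ.1 l)) ∉ Q.1 := fun h' => hl ((hc l).2 h')
        have e1 : k (Sum.inl (g.inc (Sum.inr l))) = none := dif_neg hl
        have e2 : k (Sum.inr (h.inc (Sum.inr (φ.1 l)))) = none := dif_neg hl'
        rw [e1, e2]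
    have hk' : ∀ e : (g.restrict P).E ⊕ (h.restrict Q).E,
        k (Sum.map Subtype.val Subtype.val e) = some (Quot.mk r e) := by
      rintro (e | e)
      · exact dif_pos e.2
      · exact dif_pos e.2
    intro a b hab
    obtain ⟨a, rfl⟩ := Quot.exists_rep a
    obtain ⟨b, rfl⟩ := Quot.exists_rep b
    have hab' : k (Sum.map Subtype.val Subtype.val a) = k (Sum.map Subtype.val Subtype.val b) :=
      congrArg (Quot.lift k hk) hab
    exact Option.some.inj ((hk' a).symm.trans (hab'.trans (hk' b)))
  memE := by
    intro e
    obtain ⟨e | e, rfl⟩ := Quot.exists_rep e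
    · exact (hP _).2 e.2
    · exact (hQ _).2 e.2
  surjT := by
    rintro (t | t) ht
    · exact ⟨Sum.inl ⟨t, (hP _).1 ht⟩, rfl⟩
    · exact ⟨Sum.inr ⟨t, (hQ _).1 ht⟩, rfl⟩
  surjL l := l.elim
  surjE := by
    intro e he
    obtain ⟨e | e, rfl⟩ := Quot.exists_rep e
    · exact ⟨Quot.mk _ (Sum.inl ⟨e, (hP _).1 he⟩), rfl⟩
    · exact ⟨Quot.mk _ (Sum.inr ⟨e, (hQ _).1 he⟩), rfl⟩
  rot_comm := by rintro (t | t) <;> rfl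
  col_comm l := l.elim
  incT_comm := by rintro (t | t) <;> rfl
  incL_comm l := l.elim

end Glue

end Diagram

namespace UTGraph

theorem glueCount_mk [DecidableEq (UTGraph Empty)] (Γ : UTGraph Empty) (g h : Diagram Y)
    [Fintype (Matching g h)] :
    (glueCount Γ (mk g) (mk h) : ℚ) = ∑ φ : Matching g h, if mk (g.glue h φ) = Γ then 1 else 0 := by
  have : glueCount Γ (mk g) (mk h) = Nat.card {φ : Matching g h // mk (g.glue h φ) = Γ} := rfl
  rw [this, Finset.sum_boole, Nat.card_eq_fintype_card, Fintype.card_subtype]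

/-- Splitting a glued diagram amounts to splitting the two diagrams compatibly. -/
theorem sum_matching_sum_split (g h : Diagram Y) [Fintype g.Split] [Fintype h.Split]
    [∀ (k k' : Diagram Y), Fintype (Matching k k')]
    [∀ k : Diagram Empty, Fintype k.Split] (f₁ f₂ : UTGraph Empty → ℚ) :
    ∑ φ : Matching g h, ∑ R : (g.glue h φ).Split,
        f₁ (mk ((g.glue h φ).restrict R)) * f₂ (mk ((g.glue h φ).restrict R.compl)) =
      ∑ P : g.Split, ∑ Q : h.Split,
        (∑ φ : Matching (g.restrict P) (h.restrict Q),
          f₁ (mk ((g.restrict P).glue (h.restrict Q) φ))) *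
        ∑ φ : Matching (g.restrict P.compl) (h.restrict Q.compl),
          f₂ (mk ((g.restrict P.compl).glue (h.restrict Q.compl) φ)) := by
  -- A matching with a split of the glued diagram is a pair of splits with a compatible matching,
  -- that is, with a matching of the parts and one of the complements.
  let e : ((φ : Matching g h) × (g.glue h φ).Split) ≃ ((x : g.Split × h.Split) ×
      (Matching (g.restrict x.1) (h.restrict x.2) ×
        Matching (g.restrict x.1.compl) (h.restrict x.2.compl))) :=
    ((Equiv.sigmaCongrRight splitGlueEquiv).trans
      { toFun := fun x => (⟨x.2.1, ⟨x.1, x.2.2⟩⟩ :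
          (x : g.Split × h.Split) × {φ : Matching g h // φ.Compat x})
        invFun := fun x => ⟨x.2.1, ⟨x.1, x.2.2⟩⟩
        left_inv := fun _ => rfl
        right_inv := fun _ => rfl }).trans
      (Equiv.sigmaCongrRight fun x => Matching.compatEquiv x.1 x.2)
  simp only [Finset.sum_mul_sum]
  rw [← Fintype.sum_sigma', ← Fintype.sum_prod_type']
  simp only [← Fintype.sum_prod_type']
  rw [← Fintype.sum_sigma']
  refine Fintype.sum_equiv e _ _ ?_
  rintro ⟨φ, R⟩
  congr 2
  · exact (mk_eq_mk.2 ⟨(embGlue φ R (fun _ => Iff.rfl) (fun _ => Iff.rfl)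
      (splitOfGlue_compat φ R)).iso⟩).symm
  · exact (mk_eq_mk.2 ⟨(embGlue φ R.compl (fun _ => Iff.rfl) (fun _ => Iff.rfl)
      (splitOfGlue_compat φ R).compl).iso⟩).symm

-- The count of gluings, multiplied by automorphism numbers, is a convolution over pairs of splits:
-- the analogue of `weighted_mul` for the pairing.
open Classical in
theorem aut_mul_glueCount_union (g h : Diagram Y) [Fintype g.Split] [Fintype h.Split]
    (x y : UTGraph Empty) :
    (aut (x.union y) : ℚ) * glueCount (x.union y) (mk g) (mk h) =
      aut x * aut y * ∑ P : g.Split, ∑ Q : h.Split,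
        (glueCount x (mk (g.restrict P)) (mk (h.restrict Q)) : ℚ) *
          glueCount y (mk (g.restrict P.compl)) (mk (h.restrict Q.compl)) := by
  have : ∀ (k k' : Diagram Y), Fintype (Matching k k') := fun k k' => Fintype.ofFinite _
  have : ∀ k : Diagram Empty, Fintype k.Split := fun k => Fintype.ofFinite _
  have : ∀ k : UTGraph Empty, Fintype (Decomp k) := fun k => Fintype.ofFinite _
  -- The test functions single out `x` and `y`, with the weights that make the sum over splits of
  -- the glued diagram collapse.
  have key := sum_matching_sum_split g h (fun z => (aut z : ℚ) * if z = x then 1 else 0)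
    (fun z => (aut z : ℚ) * if z = y then 1 else 0)
  have e1 : ∀ (k : Diagram Empty), ∑ R : k.Split,
      ((aut (mk (k.restrict R)) : ℚ) * if mk (k.restrict R) = x then 1 else 0) *
      ((aut (mk (k.restrict R.compl)) : ℚ) * if mk (k.restrict R.compl) = y then 1 else 0) =
      aut (x.union y) * if mk k = x.union y then 1 else 0 := by
    intro k
    have h1 := aut_mul_sum_decomp k
      (fun z w => (if z = x then 1 else 0) * (if w = y then 1 else 0))
    refine (Finset.sum_congr rfl fun R _ => mul_mul_mul_comm _ _ _ _).trans (h1.symm.trans ?_)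
    have h2 : ∀ p : Decomp (mk k), ((if p.1.1 = x then 1 else 0) * (if p.1.2 = y then 1 else 0) : ℚ)
        = if p.1 = (x, y) then 1 else 0 := by
      rintro ⟨⟨p, q⟩, -⟩
      simp only [Prod.mk.injEq]
      split_ifs <;> simp_all
    rw [Finset.sum_congr rfl fun p _ => h2 p]
    split_ifs with hk
    · rw [Finset.sum_eq_single (⟨(x, y), hk.symm⟩ : Decomp (mk k)), if_pos rfl, hk]
      · intro b _ hb
        exact if_neg fun h => hb (Subtype.ext h)
      · simp
    · rw [Finset.sum_eq_zero]
      · simp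
      · rintro ⟨p, hp⟩ -
        refine if_neg fun h => hk ?_
        rw [← hp, show p = (x, y) from h]
  have e2 : ∀ (z : UTGraph Empty) (k k' : Diagram Y), ∑ φ : Matching k k',
      ((aut (mk (k.glue k' φ)) : ℚ) * if mk (k.glue k' φ) = z then 1 else 0) =
      aut z * glueCount z (mk k) (mk k') := by
    intro z k k'
    rw [glueCount_mk, Finset.mul_sum]
    refine Finset.sum_congr rfl fun φ _ => ?_
    split_ifs with h
    · rw [h]
    · simp
  rw [Finset.sum_congr rfl fun φ _ => e1 (g.glue h φ), ← Finset.mul_sum, ← glueCount_mk] at key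
  rw [key]
  simp only [e2, Finset.mul_sum]
  refine Finset.sum_congr rfl fun P _ => Finset.sum_congr rfl fun Q _ => ?_
  ring

end UTGraph

/-! ### Multiplicativity of the pairing -/

theorem finsum_fiberwise {X Z : Type*} (m : X → Z) {f : X → ℚ} (hf : f.support.Finite) :
    ∑ᶠ x, f x = ∑ᶠ z, ∑ᶠ x : {x // m x = z}, f x := by
  classical
  have h1 : ∀ z, ∑ᶠ x : {x // m x = z}, f x = ∑ x ∈ hf.toFinset with m x = z, f x := fun z =>
    (finsum_set_coe_eq_finsum_mem {x | m x = z}).trans (finsum_mem_eq_sum_filter f _ hf)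
  rw [finsum_congr h1, finsum_eq_sum f hf,
    finsum_eq_sum_of_support_subset (s := hf.toFinset.image m),
    Finset.sum_fiberwise_of_maps_to fun x hx => Finset.mem_image_of_mem m hx]
  intro z hz
  obtain ⟨x, hx, -⟩ := Finset.exists_ne_zero_of_sum_ne_zero hz
  rw [Finset.mem_filter] at hx
  exact hx.2 ▸ Finset.mem_coe.2 (Finset.mem_image_of_mem m hx.1)

theorem finsum_mul_finsum_eq {X X' : Type*} {f : X → ℚ} {f' : X' → ℚ} (hf : f.support.Finite)
    (hf' : f'.support.Finite) :
    (∑ᶠ x, f x) * ∑ᶠ x, f' x = ∑ᶠ p : X × X', f p.1 * f' p.2 := by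
  classical
  rw [finsum_eq_sum f hf, finsum_eq_sum f' hf', Finset.sum_mul_sum, ← Finset.sum_product',
    finsum_eq_sum_of_support_subset]
  intro p hp
  rw [Finset.coe_product, Set.mem_prod]
  exact ⟨hf.mem_toFinset.2 (left_ne_zero_of_mul hp), hf'.mem_toFinset.2 (right_ne_zero_of_mul hp)⟩

namespace UTGraph

theorem eq_empty_of_mk_glue_eq_empty {g h : Diagram Y} {φ : Matching g h}
    (hφ : mk (g.glue h φ) = empty Empty) : mk g = empty Y ∧ mk h = empty Y := by
  rw [mk_eq_empty_iff] at hφ ⊢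
  rw [mk_eq_empty_iff]
  exact ⟨⟨fun e => hφ.elim (Quot.mk _ (Sum.inl e))⟩, ⟨fun e => hφ.elim (Quot.mk _ (Sum.inr e))⟩⟩

theorem exists_matching {Γ : UTGraph Empty} {g h : Diagram Y}
    (hn : glueCount Γ (mk g) (mk h) ≠ 0) : ∃ φ : Matching g h, mk (g.glue h φ) = Γ := by
  obtain ⟨⟨φ, hφ⟩⟩ := (Nat.card_ne_zero.1 hn).1
  exact ⟨φ, hφ⟩

theorem glueCount_empty : glueCount (empty Empty) (empty Y) (empty Y) = 1 := by
  have : Unique {φ : Matching (Diagram.empty Y) (Diagram.empty Y) //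
      mk ((Diagram.empty Y).glue (Diagram.empty Y) φ) = empty Empty} :=
    { default := ⟨⟨Equiv.refl _, fun l => l.elim⟩, mk_eq_empty_iff.2 ⟨fun e => by
        obtain ⟨e | e, -⟩ := Quot.exists_rep e <;> exact e.elim⟩⟩
      uniq := fun φ => Subtype.ext (Subtype.ext (Equiv.ext fun l => l.elim)) }
  exact Nat.card_unique

end UTGraph

namespace Series
open UTGraph

/-- The contribution of a pair of graphs to a coefficient of the pairing. -/
noncomputable def pairingTerm (F G : Series Y) (x : UTGraph Empty)
    (p : UTGraph Y × UTGraph Y) : ℚ :=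
  F p.1 * G p.2 * glueCount x p.1 p.2

theorem PairingDefined.finite_support {F G : Series Y} (h : PairingDefined F G)
    (x : UTGraph Empty) : (pairingTerm F G x).support.Finite := by
  refine (h x).subset fun p hp => ?_
  have hp : F p.1 * G p.2 * (glueCount x p.1 p.2 : ℚ) ≠ 0 := hp
  exact ⟨left_ne_zero_of_mul (left_ne_zero_of_mul hp),
    right_ne_zero_of_mul (left_ne_zero_of_mul hp), Nat.cast_ne_zero.1 (right_ne_zero_of_mul hp)⟩

/-- Every edge survives in the quotient, so only two empty graphs glue to the empty graph. -/
theorem pairing_empty {F G : Series Y} (hF : F (UTGraph.empty Y) = 1)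
    (hG : G (UTGraph.empty Y) = 1) : pairing F G (UTGraph.empty Empty) = 1 := by
  rw [pairing, finsum_eq_single _ (UTGraph.empty Y, UTGraph.empty Y), hF, hG, glueCount_empty]
  · norm_num
  · rintro ⟨x, y⟩ hne
    obtain ⟨g, rfl⟩ := exists_mk x
    obtain ⟨h, rfl⟩ := exists_mk y
    by_contra hn
    obtain ⟨φ, hφ⟩ := exists_matching (Nat.cast_ne_zero.1 (right_ne_zero_of_mul hn))
    obtain ⟨h1, h2⟩ := eq_empty_of_mk_glue_eq_empty hφ
    exact hne (by rw [h1, h2])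

/-- After decompositions are replaced by splits, multiplicativity makes the weights of `F` and `G`
constant factors. What remains is the convolution formula `aut_mul_glueCount_union`. -/
theorem aut_mul_sum_decomp_pairingTerm {F G : Series Y}
    (hF : ∀ x y, weighted F (x.union y) = weighted F x * weighted F y)
    (hG : ∀ x y, weighted G (x.union y) = weighted G x * weighted G y)
    (x y : UTGraph Empty) (g h : Diagram Y)
    [Fintype (Decomp (mk g))] [Fintype (Decomp (mk h))] :
    (aut x * aut y : ℚ) * ∑ q : Decomp (mk g), ∑ r : Decomp (mk h),
        pairingTerm F G x (q.1.1, r.1.1) * pairingTerm F G y (q.1.2, r.1.2) =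
      aut (x.union y) * pairingTerm F G (x.union y) (mk g, mk h) := by
  have := Fintype.ofFinite g.Split
  have := Fintype.ofFinite h.Split
  have hg := aut_ne_zero (mk g)
  have hh := aut_ne_zero (mk h)
  have key : (aut (mk g) : ℚ) * (aut (mk h) * ∑ q : Decomp (mk g), ∑ r : Decomp (mk h),
        pairingTerm F G x (q.1.1, r.1.1) * pairingTerm F G y (q.1.2, r.1.2)) =
      weighted F (mk g) * weighted G (mk h) * ∑ P : g.Split, ∑ Q : h.Split,
        (glueCount x (mk (g.restrict P)) (mk (h.restrict Q)) : ℚ) *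
          glueCount y (mk (g.restrict P.compl)) (mk (h.restrict Q.compl)) := by
    rw [Finset.mul_sum]
    simp only [fun q : Decomp (mk g) => aut_mul_sum_decomp h (fun z w =>
      pairingTerm F G x (q.1.1, z) * pairingTerm F G y (q.1.2, w))]
    rw [aut_mul_sum_decomp g (fun z' w' => ∑ Q : h.Split, aut (mk (h.restrict Q)) *
      aut (mk (h.restrict Q.compl)) * (pairingTerm F G x (z', mk (h.restrict Q)) *
        pairingTerm F G y (w', mk (h.restrict Q.compl))))]
    simp only [Finset.mul_sum]
    refine Finset.sum_congr rfl fun P _ => Finset.sum_congr rfl fun Q _ => ?_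
    rw [← mk_union_restrict g P, ← mk_union_restrict h Q, hF, hG]
    simp only [pairingTerm, weighted]
    ring
  have h2 := aut_mul_glueCount_union g h x y
  refine mul_left_cancel₀ hg (mul_left_cancel₀ hh ?_)
  simp only [pairingTerm, weighted] at key ⊢
  linear_combination (aut x * aut y : ℚ) * key -
    (aut (mk g) * F (mk g) * (aut (mk h) * G (mk h))) * h2

/-- The product of the two coefficients is a sum over pairs of pairs of graphs. It is regrouped by
their unions and evaluated fibre by fibre; definedness of the pairing makes the sum finite, which
permits the regrouping. -/
theorem weighted_pairing_union {F G : Series Y}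
    (hF : ∀ x y, weighted F (x.union y) = weighted F x * weighted F y)
    (hG : ∀ x y, weighted G (x.union y) = weighted G x * weighted G y)
    (hd : PairingDefined F G) (x y : UTGraph Empty) :
    weighted (pairing F G) (x.union y) =
      weighted (pairing F G) x * weighted (pairing F G) y := by
  have hX := hd.finite_support x
  have hY := hd.finite_support y
  let m : (UTGraph Y × UTGraph Y) × (UTGraph Y × UTGraph Y) → UTGraph Y × UTGraph Y :=
    fun q => (q.1.1.union q.2.1, q.1.2.union q.2.2)
  let W : (UTGraph Y × UTGraph Y) × (UTGraph Y × UTGraph Y) → ℚ :=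
    fun q => pairingTerm F G x q.1 * pairingTerm F G y q.2
  have hW : W.support.Finite := (hX.prod hY).subset fun q hq =>
    ⟨left_ne_zero_of_mul hq, right_ne_zero_of_mul hq⟩
  have key : ∀ p, (aut x * aut y : ℚ) * ∑ᶠ q : {q // m q = p}, W q =
      aut (x.union y) * pairingTerm F G (x.union y) p := by
    rintro ⟨z, w⟩
    obtain ⟨g, rfl⟩ := exists_mk z
    obtain ⟨h, rfl⟩ := exists_mk w
    have := Fintype.ofFinite (Decomp (mk g))
    have := Fintype.ofFinite (Decomp (mk h))
    let e : {q // m q = (mk g, mk h)} ≃ Decomp (mk g) × Decomp (mk h) :=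
      { toFun := fun q => (⟨(q.1.1.1, q.1.2.1), congrArg Prod.fst q.2⟩,
          ⟨(q.1.1.2, q.1.2.2), congrArg Prod.snd q.2⟩)
        invFun := fun r => ⟨((r.1.1.1, r.2.1.1), (r.1.1.2, r.2.1.2)), Prod.ext r.1.2 r.2.2⟩
        left_inv := fun _ => rfl
        right_inv := fun _ => rfl }
    rw [← aut_mul_sum_decomp_pairingTerm hF hG, ← finsum_comp_equiv e.symm,
      finsum_eq_sum_of_fintype, Fintype.sum_prod_type]
    rfl
  have h1 : pairing F G x * pairing F G y = ∑ᶠ q, W q := finsum_mul_finsum_eq hX hY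
  calc weighted (pairing F G) (x.union y)
      = ∑ᶠ p, aut (x.union y) * pairingTerm F G (x.union y) p :=
        mul_finsum (pairingTerm F G (x.union y)) _
    _ = ∑ᶠ p, (aut x * aut y : ℚ) * ∑ᶠ q : {q // m q = p}, W q :=
        finsum_congr fun p => (key p).symm
    _ = (aut x * aut y : ℚ) * ∑ᶠ p, ∑ᶠ q : {q // m q = p}, W q := (mul_finsum _ _).symm
    _ = weighted (pairing F G) x * weighted (pairing F G) y := by
        rw [← finsum_fiberwise m hW, ← h1, weighted, weighted]
        ring

end Series

/-! ### Finiteness -/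

namespace UTGraph

/-- The graphs with a bounded number of half-edges and edges. -/
theorem finite_setOf_card_le [Finite Y] (n : ℕ) :
    {x : UTGraph Y | ∃ g, mk g = x ∧ Nat.card g.T ≤ n ∧ Nat.card g.L ≤ n ∧
      Nat.card g.E ≤ n}.Finite := by
  -- A finite type of tables that describe diagrams on initial segments of the natural numbers.
  -- Tables that violate the axioms are sent to the empty graph, which is harmless since only the
  -- range has to be large enough.
  let D := (a : Fin (n + 1)) × (b : Fin (n + 1)) × (c : Fin (n + 1)) ×
    (Equiv.Perm (Fin a)) × (Fin b → Y) × (Fin a ⊕ Fin b → Fin c)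
  classical
  let k : D → UTGraph Y := fun ⟨a, b, c, r, col, inc⟩ =>
    if h : (∀ t, r t ≠ t) ∧ (∀ t, r (r (r t)) = t) ∧ TwoEnded inc then
      mk { T := Fin a, L := Fin b, E := Fin c, finT := inferInstance, finL := inferInstance,
           finE := inferInstance, rot := r, rot_ne := h.1, rot_rot_rot := h.2.1, col := col,
           inc := inc, twoEnded := h.2.2 }
    else empty Y
  refine (Set.finite_range k).subset ?_
  rintro _ ⟨g, rfl, hT, hL, hE⟩
  let eT := Finite.equivFin g.T
  let eL := Finite.equivFin g.L
  let eE := Finite.equivFin g.E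
  let inc : Fin (Nat.card g.T) ⊕ Fin (Nat.card g.L) → Fin (Nat.card g.E) :=
    fun x => eE (g.inc (Sum.map eT.symm eL.symm x))
  have h : (∀ t, (eT.symm.trans (g.rot.trans eT)) t ≠ t) ∧
      (∀ t, (eT.symm.trans (g.rot.trans eT)) ((eT.symm.trans (g.rot.trans eT))
        ((eT.symm.trans (g.rot.trans eT)) t)) = t) ∧ TwoEnded inc := by
    refine ⟨fun t ht => g.rot_ne (eT.symm t) (eT.injective (by simpa using ht)),
      fun t => by simp [g.rot_rot_rot], fun e => ?_⟩
    have hs : inc ⁻¹' {e} = Equiv.sumCongr eT eL '' (g.inc ⁻¹' {eE.symm e}) := by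
      rw [Equiv.image_eq_preimage_symm]
      ext (x | x) <;> simp [inc, Equiv.eq_symm_apply]
    rw [hs, Set.ncard_image_of_injective _ (Equiv.injective _)]
    exact g.twoEnded _
  refine ⟨⟨⟨_, Nat.lt_succ_of_le hT⟩, ⟨_, Nat.lt_succ_of_le hL⟩, ⟨_, Nat.lt_succ_of_le hE⟩,
    eT.symm.trans (g.rot.trans eT), fun l => g.col (eL.symm l), inc⟩, ?_⟩
  refine (dif_pos h).trans (mk_eq_mk.2 ⟨Iso.symm ⟨eT, eL, eE, fun t => ?_, fun l => ?_,
    fun x => ?_⟩⟩)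
  · change eT (g.rot (eT.symm (eT t))) = _
    rw [Equiv.symm_apply_apply]
  · change g.col (eL.symm (eL l)) = _
    rw [Equiv.symm_apply_apply]
  · rcases x with x | x <;> simp [inc]

end UTGraph

namespace Diagram

/-- In a diagram without struts the other end of the edge of a univalent vertex is a half-edge at
a trivalent vertex. -/
theorem card_L_le_card_T {g : Diagram Y} (hg : ¬ g.HasStrut) : Nat.card g.L ≤ Nat.card g.T := by
  have : ∀ l : g.L, ∃ t : g.T, g.inc (Sum.inl t) = g.inc (Sum.inr l) := by
    intro l
    by_contra! hl
    -- With neither a trivalent half-edge nor another univalent vertex, the edge would have a single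
    -- end.
    have hs : g.inc ⁻¹' {g.inc (Sum.inr l)} = {Sum.inr l} := by
      ext (t | l')
      · simpa using hl t
      · constructor
        · intro h'
          by_contra hne
          exact hg ⟨l', l, fun e => hne (by rw [e]; rfl), h'⟩
        · rintro ⟨⟩
          rfl
    have := g.twoEnded (g.inc (Sum.inr l))
    rw [hs, Set.ncard_singleton] at this
    omega
  choose f hf using this
  refine Nat.card_le_card_of_injective f fun l l' hll => ?_
  by_contra hne
  exact hg ⟨l, l', hne, by rw [← hf, ← hf, hll]⟩

variable {g h : Diagram Y} (φ : Matching g h)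

/-- An edge is determined by its image in the glued diagram together with a univalent vertex on it,
if there is one. An edge without univalent vertex is joined to nothing, so its image alone
determines it. -/
theorem card_E_le_left :
    Nat.card g.E ≤ Nat.card (g.glue h φ).E * (Nat.card g.L + 1) := by
  classical
  let f : g.E → (g.glue h φ).E × Option g.L := fun e =>
    (Quot.mk _ (Sum.inl e), if he : ∃ l, g.inc (Sum.inr l) = e then some he.choose else none)
  have hf : Function.Injective f := by
    intro e e' hee
    obtain ⟨h1, h2⟩ := Prod.mk.inj hee
    by_cases he : ∃ l, g.inc (Sum.inr l) = e
    · by_cases he' : ∃ l, g.inc (Sum.inr l) = e'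
      · rw [dif_pos he, dif_pos he'] at h2
        rw [← he.choose_spec, ← he'.choose_spec, Option.some.inj h2]
      · rw [dif_pos he, dif_neg he'] at h2
        cases h2
    · have key : ∀ a b, GlueRel g h φ a b → (a = Sum.inl e) = (b = Sum.inl e) := by
        rintro _ _ ⟨l⟩
        refine propext ⟨fun hl => absurd ⟨l, Sum.inl.inj hl⟩ he, fun hl => by cases hl⟩
      have h3 := congrArg (Quot.lift (fun a => a = Sum.inl e) key) h1
      exact (Sum.inl.inj (h3.mp rfl)).symm
  refine (Nat.card_le_card_of_injective f hf).trans ?_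
  rw [Nat.card_prod, Finite.card_option]

/-- The same argument for the other factor; the matching allows the bound to be stated with the
univalent vertices of `g`. -/
theorem card_E_le_right :
    Nat.card h.E ≤ Nat.card (g.glue h φ).E * (Nat.card g.L + 1) := by
  classical
  let f : h.E → (g.glue h φ).E × Option h.L := fun e =>
    (Quot.mk _ (Sum.inr e), if he : ∃ l, h.inc (Sum.inr l) = e then some he.choose else none)
  have hf : Function.Injective f := by
    intro e e' hee
    obtain ⟨h1, h2⟩ := Prod.mk.inj hee
    by_cases he : ∃ l, h.inc (Sum.inr l) = e
    · by_cases he' : ∃ l, h.inc (Sum.inr l) = e'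
      · rw [dif_pos he, dif_pos he'] at h2
        rw [← he.choose_spec, ← he'.choose_spec, Option.some.inj h2]
      · rw [dif_pos he, dif_neg he'] at h2
        cases h2
    · have key : ∀ a b, GlueRel g h φ a b → (a = Sum.inr e) = (b = Sum.inr e) := by
        rintro _ _ ⟨l⟩
        refine propext ⟨fun hl => (by cases hl), fun hl => absurd ⟨φ.1 l, Sum.inr.inj hl⟩ he⟩
      have h3 := congrArg (Quot.lift (fun a => a = Sum.inr e) key) h1
      exact (Sum.inr.inj (h3.mp rfl)).symm
  refine (Nat.card_le_card_of_injective f hf).trans ?_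
  rw [Nat.card_prod, Finite.card_option, Nat.card_congr φ.1]

theorem card_T_glue : Nat.card (g.glue h φ).T = Nat.card g.T + Nat.card h.T := Nat.card_sum

end Diagram

namespace UTGraph

theorem not_hasStrut_empty : ¬ (empty Y).HasStrut := fun ⟨l, _⟩ => l.elim

theorem hasStrut_union {x y : UTGraph Y} (hs : (x.union y).HasStrut) :
    x.HasStrut ∨ y.HasStrut := by
  obtain ⟨g, rfl⟩ := exists_mk x
  obtain ⟨h, rfl⟩ := exists_mk y
  obtain ⟨l | l, l' | l', hne, he⟩ := hs
  · exact Or.inl ⟨l, l', fun e => hne (congrArg Sum.inl e), Sum.inl.inj he⟩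
  · cases he
  · cases he
  · exact Or.inr ⟨l, l', fun e => hne (congrArg Sum.inr e), Sum.inr.inj he⟩

/-- Only finitely many pairs of graphs, one of which has no strut, can be glued to a given
trivalent graph. -/
theorem finite_glueCount_ne_zero [Finite Y] (Γ : UTGraph Empty) :
    {p : UTGraph Y × UTGraph Y | (¬ p.1.HasStrut ∨ ¬ p.2.HasStrut) ∧
      glueCount Γ p.1 p.2 ≠ 0}.Finite := by
  obtain ⟨γ, rfl⟩ := exists_mk Γ
  -- The first summand bounds the half-edges at trivalent vertices and the univalent vertices of
  -- both factors, the second their edges.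
  let n := Nat.card γ.T + Nat.card γ.E * (Nat.card γ.T + 1)
  refine ((finite_setOf_card_le (Y := Y) n).prod (finite_setOf_card_le (Y := Y) n)).subset ?_
  rintro ⟨x, y⟩ ⟨hs, hn⟩
  obtain ⟨g, rfl⟩ := exists_mk x
  obtain ⟨h, rfl⟩ := exists_mk y
  obtain ⟨φ, hφ⟩ := exists_matching hn
  obtain ⟨f⟩ := mk_eq_mk.1 hφ
  have hT := card_T_glue φ
  rw [Nat.card_congr f.eT] at hT
  have hL : Nat.card g.L = Nat.card h.L := Nat.card_congr φ.1
  have hE1 := card_E_le_left φ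
  have hE2 := card_E_le_right φ
  rw [Nat.card_congr f.eE] at hE1 hE2
  have hLT : Nat.card g.L ≤ Nat.card γ.T := by
    rcases hs with hs | hs
    · have := card_L_le_card_T (g := g) hs
      omega
    · have := card_L_le_card_T (g := h) hs
      omega
  have hE : Nat.card γ.E * (Nat.card g.L + 1) ≤ Nat.card γ.E * (Nat.card γ.T + 1) :=
    Nat.mul_le_mul_left _ (by omega)
  exact ⟨⟨g, rfl, by omega, by omega, by omega⟩, ⟨h, rfl, by omega, by omega, by omega⟩⟩

end UTGraph

namespace Series
open UTGraph

/-- The exponential of a strutless series is again strutless, so one side of every contributing pair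
has no strut. -/
theorem pairingDefined_exp [Finite Y] {B C : Series Y} (h : B.IsStrutless ∨ C.IsStrutless) :
    PairingDefined B.exp C.exp := fun Γ =>
  (finite_glueCount_ne_zero Γ).subset fun _ ⟨h1, h2, h3⟩ =>
    ⟨h.imp (fun h => exp_avoids not_hasStrut_empty (fun _ _ => hasStrut_union) h _ h1)
      (fun h => exp_avoids not_hasStrut_empty (fun _ _ => hasStrut_union) h _ h2), h3⟩

end Series

end UniTri

/- The exponential formula holds for all primitive `B` and `C`: the hypothesis `hCs` on struts with
two ends of the same colour is not used. -/
open UniTri in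
theorem theorem2p1 {Y : Type*} [Finite Y] (B C : Series Y)
    (hB : B.IsPrimitive) (hC : C.IsPrimitive) (hCs : C ∈ Series.Ds Y) :
    (Series.PairingDefined B.exp C.exp →
      Series.pairing B.exp C.exp = (Series.pairing B.exp C.exp).primitivePart.exp) ∧
    (B.IsStrutless ∨ C.IsStrutless → Series.PairingDefined B.exp C.exp) := by
  refine ⟨fun hd => ?_, Series.pairingDefined_exp⟩
  exact Series.eq_exp_primitivePart (Series.pairing_empty hB.exp_empty hC.exp_empty)
    (Series.weighted_pairing_union hB.weighted_exp_union hC.weighted_exp_union hd)
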